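/- Let $X,U,Y$ be complex Banach spaces, $1\le p<\infty$, and let $A$ generate a strongly continuous semigroup $\{e^{tA}\}_{t\ge 0}$ on $X$. Let $B\in\mathcal L(U,X)$ and $C\in\mathcal L(X,Y)$, and write $\mathcal B$ and $\mathcal C$ for the pointwise multiplication operators $u(\cdot)\mapsto Bu(\cdot)$ and $f(\cdot)\mapsto Cf(\cdot)$ on the $L^p$-spaces over $\mathbb R$ or $\mathbb R_+=[0,\infty)$. Let $\Gamma_{\mathbb R}$ be the generator of the semigroup $(E_{\mathbb R}^tf)(\tau)=e^{tA}f(\tau-t)$ on $L^p(\mathbb R,X)$, and let $\Gamma$ be the generator of the semigroup on $L^p(\mathbb R_+,X)$ given by $(E^tf)(\tau)=e^{tA}f(\tau-t)$ if $0\le t\le\tau$ and $(E^tf)(\tau)=0$ if $0\le\tau<t$. An operator is called invertible if $0$ belongs to its resolvent set. Let $\mathcal S(\mathbb R,U)$ be the space of $U$-valued Schwartz functions on $\mathbb R$. (i) If $\Gamma_{\mathbb R}$ is invertible on $L^p(\mathbb R,X)$, then $i\mathbb R\subset\rho(A)$, the integrals below converge absolutely, and $$\|\mathcal C\,\Gamma_{\mathbb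 R}^{-1}\mathcal B\|=\sup_{0\ne u\in\mathcal S(\mathbb R,U)}\frac{\left\|\int_{\mathbb R}C(A-is)^{-1}Bu(s)e^{is(\cdot)}\,ds\right\|_{L^p(\mathbb R,Y)}}{\left\|\int_{\mathbb R}u(s)e^{is(\cdot)}\,ds\right\|_{L^p(\mathbb R,U)}},$$ where the norm on the left is that of $\mathcal L(L^p(\mathbb R,U),L^p(\mathbb R,Y))$ and the supremum is $0$ if $U=\{0\}$. (ii) If $\Gamma$ is invertible on $L^p(\mathbb R_+,X)$, then $\Gamma_{\mathbb R}$ is invertible on $L^p(\mathbb R,X)$ (so that the formula in (i) holds), the input–output operator $$(\mathbb Lu)(t)=C\int_0^te^{(t-\tau)A}Bu(\tau)\,d\tau,\qquad t\ge 0,$$ is a bounded operator from $L^p(\mathbb R_+,U)$ to $L^p(\mathbb R_+,Y)$ with $\mathbb L=-\mathcal C\,\Gamma^{-1}\mathcal B$, and $$\|\mathbb L\|=\|\mathcal C\,\Gamma_{\mathbb R}^{-1}\mathcal B\|.$$ (iii) If, in addition to the assumption of (ii), $U$ and $Y$ are Hilbert spaces and $p=2$, then $$\|\mathbb L\|=\sup_{s\in\mathbb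 R}\|C(A-is)^{-1}B\|_{\mathcal L(U,Y)}.$$ -/

import Mathlib

open MeasureTheory Filter Topology
open scoped NNReal ENNReal SchwartzMap

namespace EvolutionSemigroup

section Abstract

variable {E : Type*} [NormedAddCommGroup E] [NormedSpace ℂ E]

/-- A strongly continuous (`C₀`) semigroup of bounded operators on `E`, with times `t ≥ 0`. -/
structure C0Semigroup (E : Type*) [NormedAddCommGroup E] [NormedSpace ℂ E] where
  /-- the operator at time `t` -/
  op : ℝ≥0 → E →L[ℂ] E
  op_zero : op 0 = ContinuousLinearMap.id ℂ E
  op_add : ∀ s t : ℝ≥0, op (s + t) = (op s).comp (op t)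
  continuous_op : ∀ x : E, Continuous fun t => op t x

/-- The graph of the infinitesimal generator of a family `S` of operators: the pairs `(x, y)` with
`(S h x - x) / h → y` as `h → 0+`. -/
def generatorGraph (S : ℝ≥0 → E →L[ℂ] E) : Submodule ℂ (E × E) where
  carrier := {q | Tendsto (fun h : ℝ≥0 => (((h : ℝ) : ℂ))⁻¹ • (S h q.1 - q.1)) (𝓝[>] 0) (𝓝 q.2)}
  zero_mem' := by simp
  add_mem' := by
    intro a b ha hb
    refine (Tendsto.add ha hb).congr fun h => ?_
    simp only [Prod.fst_add, map_add, smul_sub, smul_add]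
    abel
  smul_mem' := by
    intro c a ha
    refine (Tendsto.const_smul ha c).congr fun h => ?_
    simp only [Prod.smul_fst, map_smul, ← smul_sub]
    rw [smul_comm]

/-- The infinitesimal generator of a family `S` of operators, as an unbounded operator: its domain
is the set of all `x` for which `(S h x - x) / h` converges as `h → 0+`, and its value at such an
`x` is the limit. -/
noncomputable def generator (S : ℝ≥0 → E →L[ℂ] E) : E →ₗ.[ℂ] E :=
  (generatorGraph S).toLinearPMap

theorem mem_graph_generator (S : ℝ≥0 → E →L[ℂ] E) (x y : E) :
    (x, y) ∈ (generator S).graph ↔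
      Tendsto (fun h : ℝ≥0 => (((h : ℝ) : ℂ))⁻¹ • (S h x - x)) (𝓝[>] 0) (𝓝 y) := by
  rw [generator, Submodule.toLinearPMap_graph_eq]
  · rfl
  · rintro ⟨a, b⟩ (h : Tendsto _ _ _) (rfl : a = 0)
    refine tendsto_nhds_unique h ?_
    simp

/-- `R` is the (bounded, everywhere defined) inverse of `A - z`. -/
def IsResolventAt (A : E →ₗ.[ℂ] E) (z : ℂ) (R : E →L[ℂ] E) : Prop :=
  (∀ x : A.domain, R (A x - z • (x : E)) = x) ∧
    ∀ y : E, ∃ h : R y ∈ A.domain, A ⟨R y, h⟩ - z • R y = y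

/-- `z` belongs to the resolvent set `ρ(A)`. -/
def InResolventSet (A : E →ₗ.[ℂ] E) (z : ℂ) : Prop :=
  ∃ R : E →L[ℂ] E, IsResolventAt A z R

open Classical in
/-- The bounded operator `(A - z)⁻¹` for `z ∈ ρ(A)` (and `0` for other `z`). -/
noncomputable def res (A : E →ₗ.[ℂ] E) (z : ℂ) : E →L[ℂ] E :=
  if h : InResolventSet A z then h.choose else 0

theorem isResolventAt_res {A : E →ₗ.[ℂ] E} {z : ℂ} (h : InResolventSet A z) :
    IsResolventAt A z (res A z) := by
  rw [res, dif_pos h]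
  exact h.choose_spec

theorem IsResolventAt.unique {A : E →ₗ.[ℂ] E} {z : ℂ} {R R' : E →L[ℂ] E}
    (h : IsResolventAt A z R) (h' : IsResolventAt A z R') : R = R' := by
  ext y
  obtain ⟨hd, hy⟩ := h.2 y
  have := h'.1 ⟨R y, hd⟩
  rw [hy] at this
  exact this.symm

/-- `A` is invertible: `0 ∈ ρ(A)`. -/
def IsInvertible (A : E →ₗ.[ℂ] E) : Prop := InResolventSet A 0

/-- The bounded operator `A⁻¹`, for `A` invertible. -/
noncomputable def inv (A : E →ₗ.[ℂ] E) : E →L[ℂ] E := res A 0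

/-- The norm of `E` comes from an inner product over the given complex vector space structure;
together with `CompleteSpace E` this says that `E` is a Hilbert space. -/
def IsHilbertNorm (E : Type*) [NormedAddCommGroup E] [inst : NormedSpace ℂ E] : Prop :=
  ∃ i : InnerProductSpace ℂ E, i.toNormedSpace = inst

end Abstract

section Lp

variable {E F : Type*} [NormedAddCommGroup E] [NormedSpace ℂ E]
  [NormedAddCommGroup F] [NormedSpace ℂ F]

/-- Lebesgue measure on the half-line `ℝ₊ = [0, ∞)`. -/
noncomputable def halfVolume : Measure ℝ := volume.restrict (Set.Ici (0 : ℝ))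

/-- `L^p(ℝ, E)`. -/
noncomputable abbrev LpLine (E : Type*) [NormedAddCommGroup E] (p : ℝ≥0∞) := Lp E p (volume : Measure ℝ)

/-- `L^p(ℝ₊, E)`. -/
noncomputable abbrev LpHalf (E : Type*) [NormedAddCommGroup E] (p : ℝ≥0∞) := Lp E p halfVolume

theorem memLp_extend {G : Type*} [NormedAddCommGroup G] {p : ℝ≥0∞} (f : LpHalf G p) :
    MemLp ((Set.Ici (0 : ℝ)).indicator f) p (volume : Measure ℝ) :=
  (memLp_indicator_iff_restrict measurableSet_Ici).2 (Lp.memLp f)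

theorem indicator_ae_eq {G : Type*} [Zero G] {f g : ℝ → G} (h : f =ᵐ[halfVolume] g) :
    (Set.Ici (0 : ℝ)).indicator f =ᵐ[volume] (Set.Ici (0 : ℝ)).indicator g := by
  filter_upwards [(ae_restrict_iff' (μ := volume) measurableSet_Ici).1 h] with x hx
  by_cases hxs : x ∈ Set.Ici (0 : ℝ)
  · simp only [Set.indicator_of_mem hxs, hx hxs]
  · simp only [Set.indicator_of_notMem hxs]

variable (E) (p : ℝ≥0∞) [Fact (1 ≤ p)]

/-- Extension by zero `L^p(ℝ₊, E) → L^p(ℝ, E)`. -/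
noncomputable def extendZero : LpHalf E p →ₗᵢ[ℂ] LpLine E p where
  toFun f := (memLp_extend f).toLp _
  map_add' f g := by
    rw [← MemLp.toLp_add]
    refine MemLp.toLp_congr _ _ ?_
    refine (indicator_ae_eq (Lp.coeFn_add f g)).trans ?_
    rw [Set.indicator_add']
  map_smul' c f := by
    rw [RingHom.id_apply, ← MemLp.toLp_const_smul]
    refine MemLp.toLp_congr _ _ ?_
    refine (indicator_ae_eq (Lp.coeFn_smul c f)).trans ?_
    exact Eventually.of_forall fun x => congrFun (Set.indicator_const_smul _ c f) x
  norm_map' f := by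
    change ‖(memLp_extend f).toLp _‖ = ‖f‖
    rw [Lp.norm_toLp, Lp.norm_def, eLpNorm_indicator_eq_eLpNorm_restrict measurableSet_Ici]
    rfl

/-- Restriction `L^p(ℝ, E) → L^p(ℝ₊, E)`. -/
noncomputable def restrictHalf : LpLine E p →L[ℂ] LpHalf E p :=
  LpToLpRestrictCLM ℝ E ℂ volume p (Set.Ici 0)

/-- Translation `f ↦ f(· - t)` on `L^p(ℝ, E)`. -/
noncomputable def shift (t : ℝ) : LpLine E p →ₗᵢ[ℂ] LpLine E p :=
  Lp.compMeasurePreservingₗᵢ ℂ (fun τ => τ - t) (measurePreserving_sub_right volume t)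

variable {E}

/-- The multiplication operator `f ↦ L ∘ f` on `L^p(ℝ, ·)` induced by a bounded operator `L`. -/
noncomputable def mulLine (L : E →L[ℂ] F) : LpLine E p →L[ℂ] LpLine F p :=
  L.compLpL p volume

/-- The multiplication operator `f ↦ L ∘ f` on `L^p(ℝ₊, ·)` induced by a bounded operator `L`. -/
noncomputable def mulHalf (L : E →L[ℂ] F) : LpHalf E p →L[ℂ] LpHalf F p :=
  L.compLpL p halfVolume

/-- The evolution semigroup on `L^p(ℝ, E)`: `(E_ℝ^t f)(τ) = e^{tA} f(τ - t)`. -/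
noncomputable def evolLine (T : C0Semigroup E) (t : ℝ≥0) : LpLine E p →L[ℂ] LpLine E p :=
  (mulLine p (T.op t)).comp (shift E p t).toContinuousLinearMap

/-- The evolution semigroup on `L^p(ℝ₊, E)`: `(E^t f)(τ) = e^{tA} f(τ - t)` for `0 ≤ t ≤ τ` and
`(E^t f)(τ) = 0` for `0 ≤ τ < t`, written as: extend `f` by zero to `ℝ`, apply the operator
`E_ℝ^t`, restrict to `ℝ₊` (see `evolHalf_coeFn`). -/
noncomputable def evolHalf (T : C0Semigroup E) (t : ℝ≥0) : LpHalf E p →L[ℂ] LpHalf E p :=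
  ((restrictHalf E p).comp (evolLine p T t)).comp (extendZero E p).toContinuousLinearMap

theorem evolLine_coeFn (T : C0Semigroup E) (t : ℝ≥0) (f : LpLine E p) :
    evolLine p T t f =ᵐ[volume] fun τ => T.op t (f (τ - t)) := by
  refine (ContinuousLinearMap.coeFn_compLpL (T.op t) (shift E p t f)).trans ?_
  have h := Lp.coeFn_compMeasurePreserving f (measurePreserving_sub_right volume (t : ℝ))
  filter_upwards [h] with τ hτ
  exact congrArg (T.op t) hτ

theorem evolHalf_coeFn (T : C0Semigroup E) (t : ℝ≥0) (f : LpHalf E p) :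
    evolHalf p T t f =ᵐ[halfVolume]
      fun τ => if (t : ℝ) ≤ τ then T.op t (f (τ - t)) else 0 := by
  refine (LpToLpRestrictCLM_coeFn ℂ (Set.Ici (0 : ℝ))
    (evolLine p T t (extendZero E p f))).trans (ae_restrict_of_ae ?_)
  refine (evolLine_coeFn p T t (extendZero E p f)).trans ?_
  have h : extendZero E p f =ᵐ[volume] (Set.Ici (0 : ℝ)).indicator f :=
    MemLp.coeFn_toLp (memLp_extend f)
  have h' := (measurePreserving_sub_right volume (t : ℝ)).quasiMeasurePreserving.ae h
  filter_upwards [h'] with τ hτ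
  rw [hτ]
  by_cases hle : (t : ℝ) ≤ τ
  · have hm : τ - (t : ℝ) ∈ Set.Ici (0 : ℝ) := sub_nonneg.2 hle
    rw [if_pos hle, Set.indicator_of_mem hm]
  · have hm : τ - (t : ℝ) ∉ Set.Ici (0 : ℝ) := fun hm => hle (sub_nonneg.1 hm)
    rw [if_neg hle, Set.indicator_of_notMem hm, map_zero]

/-- `Γ_ℝ`, the generator of the evolution semigroup on `L^p(ℝ, E)`. -/
noncomputable def genLine (T : C0Semigroup E) : LpLine E p →ₗ.[ℂ] LpLine E p :=
  generator (evolLine p T)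

/-- `Γ`, the generator of the evolution semigroup on `L^p(ℝ₊, E)`. -/
noncomputable def genHalf (T : C0Semigroup E) : LpHalf E p →ₗ.[ℂ] LpHalf E p :=
  generator (evolHalf p T)

end Lp

section System

variable {X U Y : Type*} [NormedAddCommGroup X] [NormedSpace ℂ X]
  [NormedAddCommGroup U] [NormedSpace ℂ U] [NormedAddCommGroup Y] [NormedSpace ℂ Y]

/-- The operator `𝓒 Γ_ℝ⁻¹ 𝓑 : L^p(ℝ, U) → L^p(ℝ, Y)`. -/
noncomputable def sysLine (p : ℝ≥0∞) [Fact (1 ≤ p)] (T : C0Semigroup X) (B : U →L[ℂ] X)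
    (C : X →L[ℂ] Y) : LpLine U p →L[ℂ] LpLine Y p :=
  ((mulLine p C).comp (inv (genLine p T))).comp (mulLine p B)

/-- The operator `𝓒 Γ⁻¹ 𝓑 : L^p(ℝ₊, U) → L^p(ℝ₊, Y)`. -/
noncomputable def sysHalf (p : ℝ≥0∞) [Fact (1 ≤ p)] (T : C0Semigroup X) (B : U →L[ℂ] X)
    (C : X →L[ℂ] Y) : LpHalf U p →L[ℂ] LpHalf Y p :=
  ((mulHalf p C).comp (inv (genHalf p T))).comp (mulHalf p B)

/-- `L` is the input-output operator on `L^p(ℝ₊, U)`: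
`(L u)(t) = C ∫₀ᵗ e^{(t-τ)A} B u(τ) dτ` for almost all `t ≥ 0`. -/
def IsInputOutputOperator (p : ℝ≥0∞) [Fact (1 ≤ p)] (T : C0Semigroup X) (B : U →L[ℂ] X)
    (C : X →L[ℂ] Y) (L : LpHalf U p →L[ℂ] LpHalf Y p) : Prop :=
  ∀ u : LpHalf U p, L u =ᵐ[halfVolume]
    fun t => C (∫ τ in (0 : ℝ)..t, T.op (t - τ).toNNReal (B (u τ)))

/-- The transfer function on the imaginary axis, `s ↦ C (A - is)⁻¹ B`, where `A` is the generator
of the semigroup. -/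
noncomputable def transfer (T : C0Semigroup X) (B : U →L[ℂ] X) (C : X →L[ℂ] Y) (s : ℝ) :
    U →L[ℂ] Y :=
  (C.comp (res (generator T.op) (Complex.I * s))).comp B

/-- The function `τ ↦ ∫ v(s) e^{isτ} ds`. -/
noncomputable def expIntegral (v : ℝ → Y) (τ : ℝ) : Y :=
  ∫ s : ℝ, Complex.exp (Complex.I * s * τ) • v s

end System

end EvolutionSemigroup

open EvolutionSemigroup

/-!
The generator `Γ_ℝ` acts formally as `-d/dτ + A`, so that `Γ_ℝ (e^{is·} x) = e^{is·} (A - is) x` and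
`Γ_ℝ⁻¹` is the Fourier multiplier with symbol `(A - is)⁻¹`. Everything is done with the integrated
form of a generator, `A x = y` if and only if `e^{tA} x - x = ∫₀ᵗ e^{rA} y dr` for all `t`
(`C0Semigroup.mem_graph_iff_integral`), which for `Γ_ℝ` becomes a pointwise identity between
functions (`mem_graph_genLine_iff`).

*Resolvent on the imaginary axis.* Modulation by `e^{is·}` conjugates `Γ_ℝ` into the generator of the
evolution semigroup of `e^{-ist} e^{tA}`, so only `s = 0` has to be treated. Testing `Γ_ℝ` on
`∫₀ᵗ E_ℝ^r (1_[0,n) ⊗ x) dr` and letting `n → ∞` gives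
`‖∫₀ᵗ e^{rA} x dr‖ ≤ ‖Γ_ℝ⁻¹‖ ‖e^{tA} x - x‖`, hence `‖x‖ ≤ ‖Γ_ℝ⁻¹‖ ‖A x‖`
(`norm_le_of_mem_graph_of_isInvertible`). If the range of `A` were not dense, a functional vanishing
on it would be invariant under the semigroup and would turn surjectivity of `Γ_ℝ` into surjectivity
of the generator of translations on `L^p(ℝ, ℂ)`, which fails because `p < ∞`
(`shift_sub_ne_integral_box`, `dense_range_of_isInvertible`). So `‖(A - is)⁻¹‖ ≤ ‖Γ_ℝ⁻¹‖` for all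
`s`.

*The norm formula.* The resolvent identity and this uniform bound show that `s ↦ (A - is)⁻¹` is
smooth with bounded derivatives, so it maps Schwartz functions to Schwartz functions, and the
multiplier formula holds on the functions `∫ u(s) e^{is·} ds` (`sysLine_expSchwartz`). These are all
the Schwartz functions, and they are dense in `L^p`.

*The half-line.* `L^p([a, ∞), X)` is invariant under the evolution semigroup on the line, and there
`Γ_ℝ` is a translate of `Γ`. The subspaces exhaust `L^p(ℝ, X)` as `a → -∞`, which gives bounded
solvability of `Γ_ℝ u = g` (`exists_preimage_genLine`) and equality of the norms
(`norm_sysHalf_eq`); injectivity is `eq_zero_of_mem_graph_genLine`. The formula for the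
input-output operator is the integrated form of `Γ v = w` at times `t > τ`, where the translated
function vanishes (`inv_genHalf_coeFn`).

*Hilbert spaces.* Plancherel's theorem turns the norm of the multiplier into the supremum of the norm
of its symbol; the lower bound comes from bump functions concentrated near a point
(`norm_le_of_forall_integral_le`).
-/

namespace EvolutionSemigroup

/-! ### Unbounded operators and strongly continuous semigroups -/

section Graph

variable {E : Type*} [NormedAddCommGroup E] [NormedSpace ℂ E]

theorem isResolventAt_iff_graph {A : E →ₗ.[ℂ] E} {z : ℂ} {R : E →L[ℂ] E} :
    IsResolventAt A z R ↔ ∀ x y : E, (x, y + z • x) ∈ A.graph ↔ x = R y := by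
  constructor
  · rintro ⟨h1, h2⟩ x y
    constructor
    · intro h
      obtain ⟨w, hw1, hw2⟩ := A.mem_graph_iff.1 h
      simp only at hw1 hw2
      have := h1 w
      rw [hw2, hw1, add_sub_cancel_right] at this
      exact this.symm
    · rintro rfl
      obtain ⟨h, hy⟩ := h2 y
      refine A.mem_graph_iff.2 ⟨⟨R y, h⟩, rfl, ?_⟩
      exact sub_eq_iff_eq_add.1 hy
  · intro h
    refine ⟨fun x => ?_, fun y => ?_⟩
    · refine ((h x _).1 ?_).symm
      rw [sub_add_cancel]
      exact A.mem_graph x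
    · obtain ⟨w, hw1, hw2⟩ := A.mem_graph_iff.1 ((h (R y) y).2 rfl)
      simp only at hw1 hw2
      have hd : R y ∈ A.domain := hw1 ▸ w.2
      refine ⟨hd, ?_⟩
      have : w = ⟨R y, hd⟩ := Subtype.ext hw1
      rw [← this, hw2, add_sub_cancel_right]

theorem isResolventAt_zero_iff {A : E →ₗ.[ℂ] E} {R : E →L[ℂ] E} :
    IsResolventAt A 0 R ↔ ∀ x y : E, (x, y) ∈ A.graph ↔ x = R y := by
  simp [isResolventAt_iff_graph]

theorem res_eq {A : E →ₗ.[ℂ] E} {z : ℂ} {R : E →L[ℂ] E} (h : IsResolventAt A z R) :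
    res A z = R :=
  (isResolventAt_res ⟨R, h⟩).unique h

theorem mem_graph_iff_eq_inv {A : E →ₗ.[ℂ] E} (h : IsInvertible A) {x y : E} :
    (x, y) ∈ A.graph ↔ x = inv A y :=
  isResolventAt_zero_iff.1 (isResolventAt_res h) x y

theorem inv_mem_graph {A : E →ₗ.[ℂ] E} (h : IsInvertible A) (y : E) :
    (inv A y, y) ∈ A.graph :=
  (mem_graph_iff_eq_inv h).2 rfl

/-- An injective operator with a bounded choice of preimages is boundedly invertible. -/
theorem exists_isResolventAt_zero {A : E →ₗ.[ℂ] E} {c : ℝ} (hc : 0 ≤ c)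
    (hinj : ∀ x, (x, (0 : E)) ∈ A.graph → x = 0)
    (hsurj : ∀ y, ∃ x, (x, y) ∈ A.graph ∧ ‖x‖ ≤ c * ‖y‖) :
    ∃ R : E →L[ℂ] E, IsResolventAt A 0 R ∧ ‖R‖ ≤ c := by
  have huniq : ∀ {x x' y : E}, (x, y) ∈ A.graph → (x', y) ∈ A.graph → x = x' := by
    intro x x' y h h'
    refine sub_eq_zero.1 (hinj _ ?_)
    have := A.graph.sub_mem h h'
    simpa using this
  choose R hR hRn using hsurj
  let L : E →ₗ[ℂ] E :=
    { toFun := R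
      map_add' := fun a b => huniq (hR _) (A.graph.add_mem (hR a) (hR b))
      map_smul' := fun k a => huniq (hR _) (A.graph.smul_mem k (hR a)) }
  refine ⟨L.mkContinuous c hRn, isResolventAt_zero_iff.2 fun x y => ?_,
    L.mkContinuous_norm_le hc _⟩
  constructor
  · exact fun h => huniq h (hR y)
  · rintro rfl
    exact hR y

/-- If part of the graph of a closed operator has dense range and a lower bound, then every vector
has a preimage with the same bound. -/
theorem exists_preimage_of_dense [CompleteSpace E] {A : E →ₗ.[ℂ] E}
    (hA : IsClosed (A.graph : Set (E × E))) {K : Set (E × E)} (hK : K ⊆ A.graph)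
    (hsub : ∀ q ∈ K, ∀ q' ∈ K, q - q' ∈ K) {c : ℝ}
    (hbound : ∀ x y, (x, y) ∈ K → ‖x‖ ≤ c * ‖y‖) (hdense : Dense {y | ∃ x, (x, y) ∈ K}) (y : E) :
    ∃ x, (x, y) ∈ A.graph ∧ ‖x‖ ≤ c * ‖y‖ := by
  obtain ⟨v, hv, hlim⟩ := mem_closure_iff_seq_limit.1 (hdense y)
  choose u hu using hv
  have hcau : CauchySeq u := by
    rw [Metric.cauchySeq_iff']
    have hv' := hlim.cauchySeq
    rw [Metric.cauchySeq_iff'] at hv'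
    intro ε hε
    obtain ⟨N, hN⟩ := hv' (ε / (|c| + 1)) (by positivity)
    refine ⟨N, fun n hn => ?_⟩
    have h1 := hbound _ _ (hsub _ (hu n) _ (hu N))
    have h2 := hN n hn
    rw [dist_eq_norm] at h2 ⊢
    rw [lt_div_iff₀ (by positivity)] at h2
    refine lt_of_le_of_lt h1 (lt_of_le_of_lt ?_ h2)
    simp only
    nlinarith [norm_nonneg (v n - v N), le_abs_self c]
  obtain ⟨x, hx⟩ := cauchySeq_tendsto_of_complete hcau
  refine ⟨x, hA.mem_of_tendsto (hx.prodMk_nhds hlim) (Eventually.of_forall fun n => hK (hu n)), ?_⟩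
  exact le_of_tendsto_of_tendsto hx.norm (hlim.norm.const_mul c)
    (Eventually.of_forall fun n => hbound _ _ (hu n))

end Graph

/-- A strongly continuous, locally bounded family of operators is jointly continuous. -/
theorem continuous_clm_apply_of_locally_bounded {Z E F : Type*} [TopologicalSpace Z]
    [NormedAddCommGroup E] [NormedSpace ℂ E] [NormedAddCommGroup F] [NormedSpace ℂ F]
    {L : Z → E →L[ℂ] F} {h : Z → E} (hL : ∀ x, Continuous fun z => L z x)
    (hb : ∀ z, ∃ M : ℝ, ∀ᶠ w in 𝓝 z, ‖L w‖ ≤ M) (hh : Continuous h) :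
    Continuous fun z => L z (h z) := by
  rw [continuous_iff_continuousAt]
  intro z
  obtain ⟨M, hM⟩ := hb z
  have h2 : Tendsto (fun w => L w (h w - h z)) (𝓝 z) (𝓝 0) := by
    have h3 : Tendsto (fun w => M * ‖h w - h z‖) (𝓝 z) (𝓝 0) := by
      have : Continuous fun w => M * ‖h w - h z‖ := by fun_prop
      simpa using this.tendsto z
    refine squeeze_zero_norm' ?_ h3
    filter_upwards [hM] with w hw
    exact (L w).le_of_opNorm_le hw _
  have := ((hL (h z)).tendsto z).add h2
  simpa [ContinuousAt] using this

namespace C0Semigroup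

variable {E : Type*} [NormedAddCommGroup E] [NormedSpace ℂ E] (S : C0Semigroup E)

theorem op_zero_apply (x : E) : S.op 0 x = x := by simp [S.op_zero]

theorem op_add_apply (s t : ℝ≥0) (x : E) : S.op (s + t) x = S.op s (S.op t x) := by
  simp [S.op_add]

theorem continuous_orbit (x : E) : Continuous fun r : ℝ => S.op r.toNNReal x :=
  (S.continuous_op x).comp continuous_real_toNNReal

theorem exists_bound [CompleteSpace E] (a : ℝ≥0) : ∃ M : ℝ, 0 ≤ M ∧ ∀ t ≤ a, ‖S.op t‖ ≤ M := by
  obtain ⟨M, hM⟩ := banach_steinhaus (g := fun t : Set.Iic a => S.op t) (fun x => by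
    have hc : IsCompact (Set.Iic a) := by
      rw [← Set.Icc_bot]; exact isCompact_Icc
    obtain ⟨M, hM⟩ := hc.exists_bound_of_continuousOn (S.continuous_op x).continuousOn
    exact ⟨M, fun t => hM t t.2⟩)
  exact ⟨M, (norm_nonneg _).trans (hM ⟨0, zero_le (a := a)⟩), fun t ht => hM ⟨t, ht⟩⟩

theorem continuous_uncurry [CompleteSpace E] : Continuous fun q : ℝ≥0 × E => S.op q.1 q.2 := by
  refine continuous_clm_apply_of_locally_bounded (L := fun q : ℝ≥0 × E => S.op q.1)
    (fun x => (S.continuous_op x).comp continuous_fst) (fun q => ?_) continuous_snd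
  obtain ⟨M, -, hM⟩ := S.exists_bound (q.1 + 1)
  refine ⟨M, ?_⟩
  filter_upwards [(continuous_fst.tendsto q).eventually (Iio_mem_nhds (lt_add_one q.1))] with w hw
  exact hM _ hw.le

theorem mem_graph_iff_hasDerivWithinAt (x y : E) :
    (x, y) ∈ (generator S.op).graph ↔
      HasDerivWithinAt (fun r : ℝ => S.op r.toNNReal x) y (Set.Ioi 0) 0 := by
  rw [mem_graph_generator, hasDerivWithinAt_iff_tendsto_slope' (by simp)]
  have hcoe : Tendsto (fun h : ℝ≥0 => (h : ℝ)) (𝓝[>] 0) (𝓝[>] 0) :=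
    tendsto_nhdsWithin_of_tendsto_nhds_of_eventually_within _
      ((NNReal.continuous_coe.tendsto' 0 0 rfl).mono_left nhdsWithin_le_nhds)
      (by filter_upwards [self_mem_nhdsWithin] with h hh using NNReal.coe_pos.2 hh)
  have htoNN : Tendsto Real.toNNReal (𝓝[>] 0) (𝓝[>] 0) :=
    tendsto_nhdsWithin_of_tendsto_nhds_of_eventually_within _
      ((continuous_real_toNNReal.tendsto' 0 0 (by simp)).mono_left nhdsWithin_le_nhds)
      (by filter_upwards [self_mem_nhdsWithin] with h hh using Real.toNNReal_pos.2 hh)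
  constructor
  · intro h
    refine (h.comp htoNN).congr' ?_
    filter_upwards [self_mem_nhdsWithin] with r hr
    have hr' : (0 : ℝ) < r := hr
    simp only [Function.comp, slope, vsub_eq_sub, sub_zero, Real.toNNReal_zero, S.op_zero_apply,
      Real.coe_toNNReal r hr'.le]
    rw [← Complex.ofReal_inv, Complex.coe_smul]
  · intro h
    refine (h.comp hcoe).congr fun r => ?_
    simp only [Function.comp, slope, vsub_eq_sub, sub_zero, Real.toNNReal_zero, S.op_zero_apply,
      Real.toNNReal_coe]
    rw [← Complex.ofReal_inv, Complex.coe_smul]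

theorem norm_integral_orbit_le (t : ℝ≥0) {M : ℝ} (hM : ∀ r ≤ t, ‖S.op r‖ ≤ M) (x : E) :
    ‖∫ r in (0 : ℝ)..t, S.op r.toNNReal x‖ ≤ M * ‖x‖ * t := by
  have := intervalIntegral.norm_integral_le_of_norm_le_const (a := 0) (b := t)
    (f := fun r => S.op r.toNNReal x) (C := M * ‖x‖) (fun r hr => by
      rw [Set.uIoc_of_le t.coe_nonneg] at hr
      exact (S.op _).le_of_opNorm_le (hM _ (Real.toNNReal_le_iff_le_coe.2 hr.2)) x)
  simpa using this

variable [CompleteSpace E]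

theorem op_integral (t : ℝ≥0) (x : E) {a b : ℝ} (ha : 0 ≤ a) (hb : 0 ≤ b) :
    S.op t (∫ r in a..b, S.op r.toNNReal x) =
      ∫ r in a + t..b + t, S.op r.toNNReal x := by
  rw [← ContinuousLinearMap.intervalIntegral_comp_comm _
    ((S.continuous_orbit x).intervalIntegrable _ _)]
  rw [← intervalIntegral.integral_comp_add_right (fun r => S.op r.toNNReal x)]
  refine intervalIntegral.integral_congr fun r hr => ?_
  have hr0 : 0 ≤ r := (le_min ha hb).trans hr.1
  rw [← S.op_add_apply, Real.toNNReal_add hr0 t.coe_nonneg, add_comm]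
  simp

/-- The generator in integrated form: `A x = y` if and only if
`e^{tA} x - x = ∫₀ᵗ e^{rA} y dr` for all `t`. -/
theorem mem_graph_iff_integral (x y : E) :
    (x, y) ∈ (generator S.op).graph ↔
      ∀ t : ℝ≥0, S.op t x - x = ∫ r in (0 : ℝ)..t, S.op r.toNNReal y := by
  rw [mem_graph_iff_hasDerivWithinAt]
  constructor
  · intro h t
    have key : ∀ r : ℝ, 0 < r → HasDerivWithinAt (fun r : ℝ => S.op r.toNNReal x)
        (S.op r.toNNReal y) (Set.Ioi r) r := by
      intro r hr
      have h1 : HasDerivWithinAt (fun q : ℝ => S.op (q - r).toNNReal x) y (Set.Ioi r) r := by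
        have h0 : HasDerivWithinAt (fun r : ℝ => S.op r.toNNReal x) y (Set.Ioi 0) (r - r) := by
          rwa [sub_self]
        have := HasDerivWithinAt.scomp (h := fun q : ℝ => q - r) r h0
          ((hasDerivWithinAt_id r (Set.Ioi r)).sub_const r) (fun q hq => (sub_pos.2 (show r < q from hq) : 0 < q - r))
        simpa [Function.comp_def] using this
      have h2 := ((S.op r.toNNReal).restrictScalars ℝ).hasFDerivAt.comp_hasDerivWithinAt r h1
      refine h2.congr_of_eventuallyEq ?_ ?_
      · filter_upwards [self_mem_nhdsWithin] with q hq
        have hq' : 0 ≤ q - r := sub_nonneg.2 (le_of_lt hq)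
        simp only [Function.comp, ContinuousLinearMap.coe_restrictScalars']
        rw [← S.op_add_apply, ← Real.toNNReal_add hr.le hq', add_sub_cancel]
      · simp [S.op_zero_apply]
    have := intervalIntegral.integral_eq_sub_of_hasDeriv_right_of_le (a := 0) (b := t) t.coe_nonneg
      (S.continuous_orbit x).continuousOn (fun r hr => key r hr.1)
      ((S.continuous_orbit y).intervalIntegrable _ _)
    rw [this]
    simp [S.op_zero_apply]
  · intro h
    have h1 : HasDerivAt (fun u : ℝ => ∫ r in (0 : ℝ)..u, S.op r.toNNReal y) y 0 := by
      have := ((S.continuous_orbit y).integral_hasStrictDerivAt 0 0).hasDerivAt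
      simpa [S.op_zero_apply] using this
    refine (h1.hasDerivWithinAt.const_add x).congr_of_eventuallyEq ?_ ?_
    · filter_upwards [self_mem_nhdsWithin] with r hr
      have := h r.toNNReal
      rw [Real.coe_toNNReal r (le_of_lt hr)] at this
      rw [← this]
      abel
    · simp [S.op_zero_apply]

theorem isClosed_graph : IsClosed ((generator S.op).graph : Set (E × E)) := by
  have : ((generator S.op).graph : Set (E × E)) =
      ⋂ t : ℝ≥0, {q | S.op t q.1 - q.1 = ∫ r in (0 : ℝ)..t, S.op r.toNNReal q.2} := by
    ext ⟨x, y⟩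
    simp [S.mem_graph_iff_integral]
  rw [this]
  refine isClosed_iInter fun t => isClosed_eq (by fun_prop) ?_
  refine intervalIntegral.continuous_parametric_intervalIntegral_of_continuous' ?_ _ _
  exact S.continuous_uncurry.comp
    ((continuous_real_toNNReal.comp continuous_snd).prodMk (continuous_snd.comp continuous_fst))

theorem integral_orbit_mem_graph (t : ℝ≥0) (x : E) :
    (∫ r in (0 : ℝ)..t, S.op r.toNNReal x, S.op t x - x) ∈ (generator S.op).graph := by
  have hi : ∀ a b : ℝ, IntervalIntegrable (fun r : ℝ => S.op r.toNNReal x) volume a b :=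
    fun a b => (S.continuous_orbit x).intervalIntegrable a b
  refine (S.mem_graph_iff_integral _ _).2 fun s => ?_
  rw [S.op_integral s x le_rfl t.coe_nonneg]
  have h1 : ∫ r in (0 : ℝ)..s, S.op r.toNNReal (S.op t x - x) =
      (∫ r in (0 : ℝ) + t..s + t, S.op r.toNNReal x) - ∫ r in (0 : ℝ)..s, S.op r.toNNReal x := by
    rw [← S.op_integral t x le_rfl s.coe_nonneg, ← ContinuousLinearMap.intervalIntegral_comp_comm _ (hi _ _),
      ← intervalIntegral.integral_sub _ (hi _ _)]
    · refine intervalIntegral.integral_congr fun r _ => ?_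
      simp only [map_sub]
      rw [← S.op_add_apply, ← S.op_add_apply, add_comm]
    · exact ((S.op t).continuous.comp (S.continuous_orbit x)).intervalIntegrable _ _
  rw [h1, zero_add, zero_add, add_comm (s : ℝ) t]
  have h2 := intervalIntegral.integral_add_adjacent_intervals (hi 0 s) (hi s (t + s))
  have h3 := intervalIntegral.integral_add_adjacent_intervals (hi 0 t) (hi t (t + s))
  rw [sub_eq_sub_iff_add_eq_add, add_comm, h2, ← h3, add_comm]

end C0Semigroup

/-! ### Translation, multiplication and evolution operators on Lp spaces -/

section LpOperators

variable {E F : Type*} [NormedAddCommGroup E] [NormedSpace ℂ E]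
  [NormedAddCommGroup F] [NormedSpace ℂ F] {p : ℝ≥0∞} [Fact (1 ≤ p)]

theorem shift_coeFn (t : ℝ) (f : LpLine E p) : shift E p t f =ᵐ[volume] fun τ => f (τ - t) :=
  Lp.coeFn_compMeasurePreserving f (measurePreserving_sub_right volume t)

theorem mulLine_coeFn (L : E →L[ℂ] F) (f : LpLine E p) :
    mulLine p L f =ᵐ[volume] fun τ => L (f τ) :=
  ContinuousLinearMap.coeFn_compLpL L f

theorem mulHalf_coeFn (L : E →L[ℂ] F) (f : LpHalf E p) :
    mulHalf p L f =ᵐ[halfVolume] fun τ => L (f τ) :=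
  ContinuousLinearMap.coeFn_compLpL L f

theorem extendZero_coeFn (f : LpHalf E p) :
    extendZero E p f =ᵐ[volume] (Set.Ici (0 : ℝ)).indicator f :=
  MemLp.coeFn_toLp (memLp_extend f)

theorem restrictHalf_coeFn (f : LpLine E p) : restrictHalf E p f =ᵐ[halfVolume] f :=
  LpToLpRestrictCLM_coeFn ℂ (Set.Ici (0 : ℝ)) f

theorem ae_comp_sub {P : ℝ → Prop} (h : ∀ᵐ τ, P τ) (t : ℝ) : ∀ᵐ τ, P (τ - t) :=
  (measurePreserving_sub_right volume t).quasiMeasurePreserving.ae h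

theorem shift_shift (s t : ℝ) (f : LpLine E p) :
    shift E p s (shift E p t f) = shift E p (s + t) f := by
  refine Lp.ext ?_
  filter_upwards [shift_coeFn s (shift E p t f), ae_comp_sub (shift_coeFn t f) s,
    shift_coeFn (s + t) f] with τ h1 h2 h3
  rw [h1, h2, h3, sub_sub]

theorem shift_zero (f : LpLine E p) : shift E p 0 f = f := by
  refine Lp.ext ?_
  filter_upwards [shift_coeFn 0 f] with τ h1
  rw [h1, sub_zero]

theorem continuous_shift (hp : p ≠ ∞) (f : LpLine E p) : Continuous fun t => shift E p t f := by
  refine Continuous.compMeasurePreservingLp (f := fun _ : ℝ => f)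
    (g := fun t : ℝ => (⟨fun τ => τ - t, by fun_prop⟩ : C(ℝ, ℝ))) continuous_const ?_
    (fun t => measurePreserving_sub_right volume t) hp
  refine ContinuousMap.continuous_of_continuous_uncurry _ ?_
  exact continuous_snd.sub continuous_fst

theorem norm_mulLine_le (L : E →L[ℂ] F) : ‖mulLine p L‖ ≤ ‖L‖ :=
  ContinuousLinearMap.norm_compLpL_le L

theorem mulLine_shift (L : E →L[ℂ] F) (t : ℝ) (f : LpLine E p) :
    mulLine p L (shift E p t f) = shift F p t (mulLine p L f) := by
  refine Lp.ext ?_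
  filter_upwards [mulLine_coeFn L (shift E p t f), shift_coeFn t f, shift_coeFn t (mulLine p L f),
    ae_comp_sub (mulLine_coeFn L f) t] with τ h1 h2 h3 h4
  rw [h1, h2, h3, h4]

theorem mulLine_mulLine {G : Type*} [NormedAddCommGroup G] [NormedSpace ℂ G] (L : F →L[ℂ] G)
    (L' : E →L[ℂ] F) (f : LpLine E p) :
    mulLine p L (mulLine p L' f) = mulLine p (L.comp L') f := by
  refine Lp.ext ?_
  filter_upwards [mulLine_coeFn L (mulLine p L' f), mulLine_coeFn L' f,
    mulLine_coeFn (L.comp L') f] with τ h1 h2 h3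
  rw [h1, h2, h3]
  rfl

theorem mulLine_extendZero (L : E →L[ℂ] F) (f : LpHalf E p) :
    mulLine p L (extendZero E p f) = extendZero F p (mulHalf p L f) := by
  refine Lp.ext ?_
  filter_upwards [mulLine_coeFn L (extendZero E p f), extendZero_coeFn f,
    extendZero_coeFn (mulHalf p L f), indicator_ae_eq (mulHalf_coeFn L f)] with τ h1 h2 h3 h4
  rw [h1, h2, h3, h4]
  by_cases hτ : τ ∈ Set.Ici (0 : ℝ) <;> simp [hτ]

theorem restrictHalf_extendZero (f : LpHalf E p) : restrictHalf E p (extendZero E p f) = f := by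
  refine Lp.ext ?_
  filter_upwards [restrictHalf_coeFn (extendZero E p f), ae_restrict_of_ae (extendZero_coeFn f),
    ae_restrict_mem (μ := volume) measurableSet_Ici] with τ h1 h2 h3
  rw [h1, h2, Set.indicator_of_mem h3]

theorem extendZero_restrictHalf_coeFn (f : LpLine E p) :
    extendZero E p (restrictHalf E p f) =ᵐ[volume] (Set.Ici (0 : ℝ)).indicator f :=
  (extendZero_coeFn _).trans (indicator_ae_eq (restrictHalf_coeFn f))

theorem norm_extendZero_restrictHalf_le (f : LpLine E p) :
    ‖extendZero E p (restrictHalf E p f)‖ ≤ ‖f‖ := by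
  refine Lp.norm_le_norm_of_ae_le ?_
  filter_upwards [extendZero_restrictHalf_coeFn f] with τ h
  rw [h]
  exact norm_indicator_le_norm_self _ _

theorem mulLine_add_left (L L' : E →L[ℂ] F) (f : LpLine E p) :
    mulLine p (L + L') f = mulLine p L f + mulLine p L' f := by
  refine Lp.ext ?_
  filter_upwards [mulLine_coeFn (L + L') f, mulLine_coeFn L f, mulLine_coeFn L' f,
    Lp.coeFn_add (mulLine p L f) (mulLine p L' f)] with τ h1 h2 h3 h4
  rw [h1, h4, Pi.add_apply, h2, h3, add_apply]

theorem mulLine_smul_left (c : ℂ) (L : E →L[ℂ] F) (f : LpLine E p) :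
    mulLine p (c • L) f = c • mulLine p L f := by
  refine Lp.ext ?_
  filter_upwards [mulLine_coeFn (c • L) f, mulLine_coeFn L f,
    Lp.coeFn_smul c (mulLine p L f)] with τ h1 h2 h3
  rw [h1, h3, Pi.smul_apply, h2, smul_apply]

theorem norm_mulLine_toSpanSingleton_le (x : E) (φ : LpLine ℂ p) :
    ‖mulLine p (ContinuousLinearMap.toSpanSingleton ℂ x) φ‖ ≤ ‖φ‖ * ‖x‖ := by
  have h := (mulLine p (ContinuousLinearMap.toSpanSingleton ℂ x)).le_of_opNorm_le
    (norm_mulLine_le _) φ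
  rw [ContinuousLinearMap.norm_toSpanSingleton] at h
  exact h.trans_eq (mul_comm _ _)

/-- The map `x ↦ φ(·) x` from `E` to `L^p(ℝ, E)`, as a linear map. -/
noncomputable def tensorLinear (φ : LpLine ℂ p) : E →ₗ[ℂ] LpLine E p where
  toFun x := mulLine p (ContinuousLinearMap.toSpanSingleton ℂ x) φ
  map_add' x y := by
    rw [ContinuousLinearMap.toSpanSingleton_add, mulLine_add_left]
  map_smul' c x := by
    rw [ContinuousLinearMap.toSpanSingleton_smul, mulLine_smul_left, RingHom.id_apply]

/-- The embedding `x ↦ φ(·) x` of `E` into `L^p(ℝ, E)` given by a scalar function `φ`. -/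
noncomputable def tensor (φ : LpLine ℂ p) : E →L[ℂ] LpLine E p :=
  (tensorLinear φ).mkContinuous ‖φ‖ fun x => norm_mulLine_toSpanSingleton_le x φ

theorem tensor_coeFn (φ : LpLine ℂ p) (x : E) : tensor φ x =ᵐ[volume] fun τ => φ τ • x :=
  mulLine_coeFn _ φ

theorem norm_tensor_apply (φ : LpLine ℂ p) (x : E) : ‖tensor φ x‖ = ‖φ‖ * ‖x‖ := by
  have h : eLpNorm (tensor φ x) p volume = eLpNorm (‖x‖ • (fun τ => ‖φ τ‖)) p volume := by
    refine eLpNorm_congr_norm_ae ?_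
    filter_upwards [tensor_coeFn φ x] with τ h
    rw [h, norm_smul]
    simp [mul_comm]
  rw [Lp.norm_def, h, eLpNorm_const_smul, eLpNorm_norm, ENNReal.toReal_mul, Lp.norm_def, mul_comm]
  simp

theorem shift_tensor (t : ℝ) (φ : LpLine ℂ p) (x : E) :
    shift E p t (tensor φ x) = tensor (shift ℂ p t φ) x := (mulLine_shift _ _ _).symm

theorem mulLine_tensor (L : E →L[ℂ] F) (φ : LpLine ℂ p) (x : E) :
    mulLine p L (tensor φ x) = tensor φ (L x) := by
  refine Lp.ext ?_
  filter_upwards [mulLine_coeFn L (tensor φ x), tensor_coeFn φ x, tensor_coeFn φ (L x)]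
    with τ h1 h2 h3
  rw [h1, h2, h3, map_smul]

theorem tensor_sub_left (φ ψ : LpLine ℂ p) (x : E) :
    tensor (φ - ψ) x = tensor φ x - tensor ψ x := map_sub (mulLine p _) φ ψ

theorem continuous_mulLine_apply (hp : p ≠ ∞) {L : ℝ≥0 → E →L[ℂ] F}
    (hL : ∀ x, Continuous fun t => L t x) (hb : ∀ t, ∃ M : ℝ, ∀ᶠ r in 𝓝 t, ‖L r‖ ≤ M)
    (f : LpLine E p) : Continuous fun t => mulLine p (L t) f := by
  induction f using Lp.induction hp with
  | @indicatorConst c s hs hμs =>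
    rw [Lp.simpleFunc.coe_indicatorConst]
    have : indicatorConstLp p hs hμs.ne c = tensor (indicatorConstLp p hs hμs.ne (1 : ℂ)) c := by
      refine Lp.ext ?_
      filter_upwards [tensor_coeFn (indicatorConstLp p hs hμs.ne (1 : ℂ)) c,
        indicatorConstLp_coeFn (p := p) (hs := hs) (hμs := hμs.ne) (c := c),
        indicatorConstLp_coeFn (p := p) (hs := hs) (hμs := hμs.ne) (c := (1 : ℂ))] with τ h1 h2 h3
      rw [h1, h2, h3]
      by_cases hτ : τ ∈ s <;> simp [hτ]
    simp only [this, mulLine_tensor]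
    exact (tensor _).continuous.comp (hL c)
  | add hf hg _ ihf ihg => simp only [map_add]; exact ihf.add ihg
  | isClosed =>
    refine isClosed_of_closure_subset fun f hf => ?_
    simp only [Set.mem_ofPred_eq, continuous_iff_continuousAt]
    intro t
    refine continuousAt_of_locally_uniform_approx_of_continuousAt fun u hu => ?_
    obtain ⟨ε, hε, hεu⟩ := Metric.mem_uniformity_dist.1 hu
    obtain ⟨M, hM⟩ := hb t
    obtain ⟨g, hg, hfg⟩ := Metric.mem_closure_iff.1 hf (ε / (|M| + 1)) (by positivity)
    refine ⟨_, hM, fun t => mulLine p (L t) g, (hg : Continuous _).continuousAt, fun r hr => ?_⟩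
    refine hεu ?_
    rw [dist_eq_norm] at hfg ⊢
    rw [← map_sub]
    rw [lt_div_iff₀ (by positivity)] at hfg
    refine lt_of_le_of_lt ((mulLine p (L r)).le_of_opNorm_le ((norm_mulLine_le _).trans hr) _) ?_
    nlinarith [norm_nonneg (f - g), le_abs_self M]

end LpOperators

section EvolutionSemigroups

variable {E F : Type*} [NormedAddCommGroup E] [NormedSpace ℂ E]
  [NormedAddCommGroup F] [NormedSpace ℂ F] {p : ℝ≥0∞} [Fact (1 ≤ p)]

theorem evolLine_apply (T : C0Semigroup E) (t : ℝ≥0) (f : LpLine E p) :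
    evolLine p T t f = mulLine p (T.op t) (shift E p t f) := rfl

theorem evolLine_shift (T : C0Semigroup E) (t : ℝ≥0) (a : ℝ) (f : LpLine E p) :
    evolLine p T t (shift E p a f) = shift E p a (evolLine p T t f) := by
  rw [evolLine_apply, evolLine_apply, mulLine_shift, mulLine_shift, mulLine_shift, shift_shift,
    shift_shift, add_comm]

theorem evolLine_tensor (T : C0Semigroup E) (t : ℝ≥0) (φ : LpLine ℂ p) (x : E) :
    evolLine p T t (tensor φ x) = tensor (shift ℂ p t φ) (T.op t x) := by
  rw [evolLine_apply, shift_tensor, mulLine_tensor]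

theorem extendZero_evolHalf (T : C0Semigroup E) (t : ℝ≥0) (f : LpHalf E p) :
    extendZero E p (evolHalf p T t f) = evolLine p T t (extendZero E p f) := by
  refine Lp.ext ?_
  filter_upwards [extendZero_coeFn (evolHalf p T t f), indicator_ae_eq (evolHalf_coeFn p T t f),
    evolLine_coeFn p T t (extendZero E p f), ae_comp_sub (extendZero_coeFn f) t] with τ h1 h2 h3 h4
  rw [h1, h2, h3, h4]
  have ht : (0 : ℝ) ≤ t := t.coe_nonneg
  by_cases h : (t : ℝ) ≤ τ
  · have h5 : τ ∈ Set.Ici (0 : ℝ) := ht.trans h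
    have h6 : τ - t ∈ Set.Ici (0 : ℝ) := sub_nonneg.2 h
    rw [Set.indicator_of_mem h5, Set.indicator_of_mem h6, if_pos h]
  · have h6 : τ - t ∉ Set.Ici (0 : ℝ) := fun h' => h (sub_nonneg.1 h')
    rw [Set.indicator_of_notMem h6, map_zero]
    by_cases h5 : τ ∈ Set.Ici (0 : ℝ)
    · rw [Set.indicator_of_mem h5, if_neg h]
    · rw [Set.indicator_of_notMem h5]

variable [CompleteSpace E]

/-- The evolution semigroup on `L^p(ℝ, E)` as a strongly continuous semigroup. -/
noncomputable def lineSemigroup (hp : p ≠ ∞) (T : C0Semigroup E) : C0Semigroup (LpLine E p) where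
  op := evolLine p T
  op_zero := by
    ext1 f
    rw [evolLine_apply, T.op_zero]
    refine Lp.ext ?_
    filter_upwards [mulLine_coeFn (ContinuousLinearMap.id ℂ E) (shift E p 0 f), shift_coeFn 0 f]
      with τ h1 h2
    simpa [h2] using h1
  op_add s t := by
    ext1 f
    rw [ContinuousLinearMap.comp_apply, evolLine_apply, evolLine_apply, evolLine_apply,
      ← mulLine_shift, shift_shift, mulLine_mulLine, T.op_add, NNReal.coe_add]
  continuous_op f := by
    have hb : ∀ t : ℝ≥0, ∃ M : ℝ, ∀ᶠ r in 𝓝 t, ‖T.op r‖ ≤ M := by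
      intro t
      obtain ⟨M, -, hM⟩ := T.exists_bound (t + 1)
      refine ⟨M, ?_⟩
      filter_upwards [Iio_mem_nhds (lt_add_one t)] with r hr
      exact hM _ (le_of_lt hr)
    refine continuous_clm_apply_of_locally_bounded (L := fun t => mulLine p (T.op t))
      (h := fun t : ℝ≥0 => shift E p t f) (continuous_mulLine_apply hp T.continuous_op hb)
      (fun t => ?_) ((continuous_shift hp f).comp NNReal.continuous_coe)
    obtain ⟨M, hM⟩ := hb t
    exact ⟨M, hM.mono fun r hr => (norm_mulLine_le _).trans hr⟩

omit [CompleteSpace E] in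
/-- A bounded operator intertwining two families intertwines their generators. -/
theorem generator_graph_map {S : ℝ≥0 → E →L[ℂ] E} {S' : ℝ≥0 → F →L[ℂ] F} (J : E →L[ℂ] F)
    (hJ : ∀ t x, J (S t x) = S' t (J x)) {x y : E} (h : (x, y) ∈ (generator S).graph) :
    (J x, J y) ∈ (generator S').graph := by
  rw [mem_graph_generator] at h ⊢
  refine ((J.continuous.tendsto y).comp h).congr fun t => ?_
  simp [hJ]

omit [CompleteSpace E] in
theorem mem_graph_genHalf_iff (T : C0Semigroup E) (f g : LpHalf E p) :
    (f, g) ∈ (genHalf p T).graph ↔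
      (extendZero E p f, extendZero E p g) ∈ (genLine p T).graph := by
  constructor
  · exact generator_graph_map (extendZero E p).toContinuousLinearMap (extendZero_evolHalf T)
  · intro h
    rw [genLine, mem_graph_generator] at h
    rw [genHalf, mem_graph_generator]
    rw [(extendZero E p).isometry.isEmbedding.tendsto_nhds_iff]
    refine h.congr fun t => ?_
    simp [extendZero_evolHalf]

omit [CompleteSpace E] in
theorem shift_mem_graph_genLine {T : C0Semigroup E} {f g : LpLine E p}
    (h : (f, g) ∈ (genLine p T).graph) (a : ℝ) :
    (shift E p a f, shift E p a g) ∈ (genLine p T).graph :=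
  generator_graph_map (shift E p a).toContinuousLinearMap
    (fun t x => (evolLine_shift T t a x).symm) h

end EvolutionSemigroups

/-! ### Integrals with values in Lp -/

section LpIntegral

variable {E : Type*} [NormedAddCommGroup E] [NormedSpace ℂ E] {p : ℝ≥0∞} [Fact (1 ≤ p)]

omit [NormedSpace ℂ E] in
theorem integrableOn_of_Lp (f : LpLine E p) {s : Set ℝ} (hμs : volume s < ∞) :
    IntegrableOn f s volume := by
  have : IsFiniteMeasure (volume.restrict s) := ⟨by simpa using hμs⟩
  exact ((Lp.memLp f).restrict s).integrable Fact.out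

/-- Multiplication by the indicator function of a set of finite measure, from `L^p` to `L^1`. -/
noncomputable def indicatorL1 {s : Set ℝ} (hs : MeasurableSet s) (hμs : volume s < ∞) :
    LpLine E p →L[ℂ] LpLine E 1 :=
  haveI : Fact (1 ≤ p.conjExponent) := ⟨by simp [ENNReal.conjExponent]⟩
  (ContinuousLinearMap.lsmul ℂ ℂ : ℂ →L[ℂ] E →L[ℂ] E).holderL volume p.conjExponent p 1
    (indicatorConstLp _ hs hμs.ne (1 : ℂ))

theorem indicatorL1_coeFn {s : Set ℝ} (hs : MeasurableSet s) (hμs : volume s < ∞)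
    (f : LpLine E p) : indicatorL1 hs hμs f =ᵐ[volume] s.indicator f := by
  have : Fact (1 ≤ p.conjExponent) := ⟨by simp [ENNReal.conjExponent]⟩
  have h := (ContinuousLinearMap.lsmul ℂ ℂ : ℂ →L[ℂ] E →L[ℂ] E).coeFn_holder (r := 1)
    (indicatorConstLp p.conjExponent hs hμs.ne (1 : ℂ)) f
  filter_upwards [h, indicatorConstLp_coeFn (p := p.conjExponent) (hs := hs) (hμs := hμs.ne)
    (c := (1 : ℂ))] with τ h1 h2
  refine h1.trans ?_
  rw [h2]
  by_cases hτ : τ ∈ s <;> simp [hτ]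

variable [CompleteSpace E]

/-- Bochner integrals with values in `L^p` can be evaluated pointwise. -/
theorem intervalIntegral_Lp_coeFn {G : ℝ → LpLine E p} (hG : Continuous G) {k : ℝ → ℝ → E}
    (hk : StronglyMeasurable (Function.uncurry k)) (hGk : ∀ r, G r =ᵐ[volume] k r)
    {a b : ℝ} (hab : a ≤ b) :
    (∫ r in a..b, G r : LpLine E p) =ᵐ[volume] fun τ => ∫ r in a..b, k r τ := by
  set ν : Measure ℝ := volume.restrict (Set.Ioc a b)
  have hprod : ∀ s : Set ℝ, MeasurableSet s → volume s < ∞ →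
      Integrable (Function.uncurry k) (ν.prod (volume.restrict s)) := by
    intro s hs hμs
    rw [integrable_prod_iff hk.aestronglyMeasurable]
    constructor
    · refine Eventually.of_forall fun r => ?_
      exact (integrableOn_of_Lp (G r) hμs).congr (ae_restrict_of_ae (hGk r))
    · have : (fun r => ∫ τ in s, ‖Function.uncurry k (r, τ)‖) =
          fun r => ‖indicatorL1 hs hμs (G r)‖ := by
        ext r
        rw [L1.norm_eq_integral_norm, ← integral_indicator hs]
        refine integral_congr_ae ?_
        filter_upwards [hGk r, indicatorL1_coeFn hs hμs (G r)] with τ h1 h2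
        rw [h2]
        by_cases hτ : τ ∈ s <;> simp [hτ, h1, Function.uncurry]
      rw [this]
      exact (((indicatorL1 hs hμs).continuous.comp hG).norm.integrableOn_Icc).mono_set
        Set.Ioc_subset_Icc_self
  -- Both sides have the same integral over every set of finite measure, by Fubini.
  refine ae_eq_of_forall_setIntegral_eq_of_sigmaFinite (fun s _ hμs => integrableOn_of_Lp _ hμs)
    (fun s hs hμs => ?_) (fun s hs hμs => ?_)
  · have := (hprod s hs hμs).integral_prod_right
    simp only [intervalIntegral.integral_of_le hab]
    exact this
  · have hL : ∀ f : LpLine E p, ∫ τ in s, f τ = L1.integralCLM' ℂ (indicatorL1 hs hμs f) := by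
      intro f
      have h1 : L1.integralCLM' ℂ (indicatorL1 hs hμs f) = L1.integral (indicatorL1 hs hμs f) := by
        rw [L1.integral_eq' (𝕜 := ℂ)]
      rw [h1, L1.integral_eq_integral, ← integral_indicator hs]
      exact (integral_congr_ae (indicatorL1_coeFn hs hμs f)).symm
    have hcl := ContinuousLinearMap.intervalIntegral_comp_comm
      ((L1.integralCLM' ℂ).comp (indicatorL1 (E := E) (p := p) hs hμs))
      (hG.intervalIntegrable (μ := volume) a b)
    rw [hL]
    refine hcl.symm.trans ?_
    simp only [ContinuousLinearMap.comp_apply, ← hL, intervalIntegral.integral_of_le hab]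
    have hsw := integral_integral_swap (f := k) (hprod s hs hμs)
    rw [← hsw]
    refine integral_congr_ae (Eventually.of_forall fun r => ?_)
    exact integral_congr_ae (ae_restrict_of_ae (hGk r))

theorem stronglyMeasurable_op_comp_sub (T : C0Semigroup E) {g : ℝ → E}
    (hg : StronglyMeasurable g) :
    StronglyMeasurable (Function.uncurry fun r τ : ℝ => T.op r.toNNReal (g (τ - r))) := by
  have h1 : StronglyMeasurable fun q : ℝ × ℝ => q.1.toNNReal :=
    (measurable_real_toNNReal.comp measurable_fst).stronglyMeasurable
  have h2 : StronglyMeasurable fun q : ℝ × ℝ => g (q.2 - q.1) :=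
    hg.comp_measurable (measurable_snd.sub measurable_fst)
  exact T.continuous_uncurry.comp_stronglyMeasurable (h1.prodMk h2)

theorem integral_evolLine_coeFn (hp : p ≠ ∞) (T : C0Semigroup E) (g : LpLine E p) (t : ℝ≥0) :
    (∫ r in (0 : ℝ)..t, evolLine p T r.toNNReal g : LpLine E p) =ᵐ[volume]
      fun τ => ∫ r in (0 : ℝ)..t, T.op r.toNNReal (g (τ - r)) := by
  have h1 := intervalIntegral_Lp_coeFn ((lineSemigroup hp T).continuous_orbit g)
    (k := fun r τ => T.op r.toNNReal (g (τ - r.toNNReal)))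
    (by
      have := (stronglyMeasurable_op_comp_sub T (Lp.stronglyMeasurable g)).comp_measurable
        (((measurable_real_toNNReal.coe_nnreal_real).comp measurable_fst).prodMk
          (measurable_snd (α := ℝ) (β := ℝ)))
      convert this using 1
      funext q
      simp only [Function.uncurry, Function.comp, Real.toNNReal_coe])
    (fun r => evolLine_coeFn p T r.toNNReal g) t.coe_nonneg
  refine h1.trans (Eventually.of_forall fun τ => ?_)
  refine intervalIntegral.integral_congr fun r hr => ?_
  rw [Set.uIcc_of_le t.coe_nonneg] at hr
  simp only [Real.coe_toNNReal r hr.1]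

/-- The generator of the evolution semigroup on the line, in pointwise integrated form. -/
theorem mem_graph_genLine_iff (hp : p ≠ ∞) (T : C0Semigroup E) (u g : LpLine E p) :
    (u, g) ∈ (genLine p T).graph ↔ ∀ t : ℝ≥0, ∀ᵐ τ : ℝ,
      T.op t (u (τ - t)) - u τ = ∫ r in (0 : ℝ)..t, T.op r.toNNReal (g (τ - r)) := by
  refine ((lineSemigroup hp T).mem_graph_iff_integral u g).trans (forall_congr' fun t => ?_)
  have h1 : (evolLine p T t u - u : LpLine E p) =ᵐ[volume]
      fun τ => T.op t (u (τ - t)) - u τ := by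
    filter_upwards [Lp.coeFn_sub (evolLine p T t u) u, evolLine_coeFn p T t u] with τ h1 h2
    rw [h1, Pi.sub_apply, h2]
  have h2 := integral_evolLine_coeFn hp T g t
  constructor
  · intro h
    have h' : evolLine p T t u - u = ∫ r in (0 : ℝ)..t, evolLine p T r.toNNReal g := h
    rw [← h'] at h2
    exact h1.symm.trans h2
  · intro h
    exact Lp.ext (h1.trans (EventuallyEq.trans h h2.symm))

end LpIntegral

/-! ### The resolvent of the generator at the origin -/

section Box

variable {p : ℝ≥0∞} [Fact (1 ≤ p)]

/-- The indicator function of `[0, a)` as an element of `L^p(ℝ, ℂ)`. -/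
noncomputable def box (p : ℝ≥0∞) [Fact (1 ≤ p)] (a : ℝ) : LpLine ℂ p :=
  indicatorConstLp p (measurableSet_Ico (a := 0) (b := a)) (by simp) (1 : ℂ)

theorem box_coeFn (a : ℝ) : box p a =ᵐ[volume] (Set.Ico 0 a).indicator fun _ => (1 : ℂ) :=
  indicatorConstLp_coeFn

theorem norm_box (hp : p ≠ ∞) {a : ℝ} (ha : 0 ≤ a) : ‖box p a‖ = a ^ (1 / p.toReal) := by
  have hp0 : p ≠ 0 := (one_pos.trans_le (Fact.out : 1 ≤ p)).ne'
  rw [box, norm_indicatorConstLp hp0 hp]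
  simp [ha]

theorem norm_box_le (hp : p ≠ ∞) {a b : ℝ} (ha : 0 ≤ a) (hab : a ≤ b) :
    ‖box p a‖ ≤ ‖box p b‖ := by
  rw [norm_box hp ha, norm_box hp (ha.trans hab)]
  exact Real.rpow_le_rpow ha hab (by positivity)

theorem tendsto_norm_box (hp : p ≠ ∞) : Tendsto (fun n : ℕ => ‖box p n‖) atTop atTop := by
  have hp0 : 0 < p.toReal :=
    ENNReal.toReal_pos (one_pos.trans_le (Fact.out : 1 ≤ p)).ne' hp
  simp only [norm_box hp (Nat.cast_nonneg _)]
  exact (tendsto_rpow_atTop (by positivity)).comp tendsto_natCast_atTop_atTop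

theorem box_add {a b : ℝ} (ha : 0 ≤ a) (hb : 0 ≤ b) :
    box p (a + b) = box p a + shift ℂ p a (box p b) := by
  refine Lp.ext ?_
  filter_upwards [box_coeFn (p := p) (a + b), box_coeFn (p := p) a,
    shift_coeFn a (box p b), ae_comp_sub (box_coeFn (p := p) b) a,
    Lp.coeFn_add (box p a) (shift ℂ p a (box p b))] with τ h1 h2 h3 h4 h5
  rw [h1, h5, Pi.add_apply, h2, h3, h4]
  simp only [Set.indicator_apply, Set.mem_Ico]
  by_cases h0 : 0 ≤ τ <;> by_cases h6 : τ < a <;> by_cases h7 : τ < a + b <;>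
    simp [h0, h6, h7, sub_lt_iff_lt_add'] <;> linarith

theorem shift_box_sub {a r : ℝ} (ha : 0 ≤ a) (hr : 0 ≤ r) :
    shift ℂ p r (box p a) - box p a = shift ℂ p a (box p r) - box p r := by
  have h1 := box_add (p := p) ha hr
  have h2 := box_add (p := p) hr ha
  rw [add_comm r a, h1] at h2
  rw [sub_eq_sub_iff_add_eq_add, add_comm, ← h2, add_comm]

/-- Translating a long box by a bounded amount changes it by a bounded amount, uniformly in the
length of the box. -/
theorem norm_shift_box_sub_le (hp : p ≠ ∞) {a r t : ℝ} (ha : 0 ≤ a) (hr : 0 ≤ r) (hrt : r ≤ t) :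
    ‖shift ℂ p r (box p a) - box p a‖ ≤ 2 * ‖box p t‖ := by
  rw [shift_box_sub ha hr]
  refine (norm_sub_le _ _).trans ?_
  rw [LinearIsometry.norm_map]
  linarith [norm_box_le (p := p) hp hr hrt]

theorem norm_integral_shift_box_sub_le (hp : p ≠ ∞) (n : ℕ) :
    ‖(∫ r in (0 : ℝ)..1, shift ℂ p r (box p n)) - box p n‖ ≤ 2 * ‖box p 1‖ := by
  have hc : Continuous fun r => shift ℂ p r (box p n) := continuous_shift hp _
  have h : (∫ r in (0 : ℝ)..1, shift ℂ p r (box p n)) - box p n =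
      ∫ r in (0 : ℝ)..1, (shift ℂ p r (box p n) - box p n) := by
    rw [intervalIntegral.integral_sub (hc.intervalIntegrable _ _)
      (continuous_const.intervalIntegrable _ _)]
    simp
  rw [h]
  have := intervalIntegral.norm_integral_le_of_norm_le_const (a := (0 : ℝ)) (b := 1)
    (f := fun r => shift ℂ p r (box p n) - box p n) (C := 2 * ‖box p 1‖) (fun r hr => by
      rw [Set.uIoc_of_le zero_le_one] at hr
      exact norm_shift_box_sub_le hp (Nat.cast_nonneg n) hr.1.le hr.2)
  simpa using this

/-- The translation semigroup on `L^p(ℝ, ℂ)` has a non-surjective generator: `1_[0,1)` has no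
preimage, since the integrals `∫₀ⁿ 1_[0,1)(· - r) dr` are unbounded in `L^p`. -/
theorem shift_sub_ne_integral_box (hp : p ≠ ∞) (a : LpLine ℂ p) :
    shift ℂ p 1 a - a ≠ ∫ r in (0 : ℝ)..1, shift ℂ p r (box p 1) := by
  intro h
  have hc : ∀ f : LpLine ℂ p, IntervalIntegrable (fun r => shift ℂ p r f) volume 0 1 :=
    fun f => (continuous_shift hp f).intervalIntegrable _ _
  -- Iterating the equation turns `1_[0,1)` into `1_[0,n)` on the right, while the norm of the left
  -- side stays below `2 ‖a‖`.
  have key : ∀ n : ℕ, shift ℂ p n a - a = ∫ r in (0 : ℝ)..1, shift ℂ p r (box p n) := by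
    intro n
    induction n with
    | zero =>
      have h0 : box p ((0 : ℕ) : ℝ) = 0 := by
        rw [← norm_eq_zero, norm_box hp (Nat.cast_nonneg _)]
        have hp0 : 0 < p.toReal :=
          ENNReal.toReal_pos (one_pos.trans_le (Fact.out : 1 ≤ p)).ne' hp
        rw [Nat.cast_zero, Real.zero_rpow (by positivity)]
      rw [h0]
      simp [shift_zero]
    | succ n ih =>
      have h1 : shift ℂ p n (∫ r in (0 : ℝ)..1, shift ℂ p r (box p 1)) =
          ∫ r in (0 : ℝ)..1, shift ℂ p r (shift ℂ p n (box p 1)) := by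
        have := ContinuousLinearMap.intervalIntegral_comp_comm
          (shift ℂ p n).toContinuousLinearMap (hc (box p 1))
        refine this.symm.trans (intervalIntegral.integral_congr fun r _ => ?_)
        simp only [LinearIsometry.coe_toContinuousLinearMap]
        rw [shift_shift, shift_shift, add_comm]
      rw [Nat.cast_succ, box_add (Nat.cast_nonneg n) zero_le_one]
      simp only [map_add]
      rw [intervalIntegral.integral_add (hc _) (hc _), ← ih, ← h1, ← h, map_sub, shift_shift]
      abel
  obtain ⟨n, hn⟩ := ((tendsto_norm_box (p := p) hp).eventually_gt_atTop
    (2 * ‖a‖ + 2 * ‖box p 1‖)).exists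
  have h1 := norm_integral_shift_box_sub_le (p := p) hp n
  rw [← key n] at h1
  have h2 : ‖box p n‖ ≤ ‖(shift ℂ p n a - a) - box p n‖ + ‖shift ℂ p n a - a‖ := by
    have := norm_sub_le (shift ℂ p n a - a) ((shift ℂ p n a - a) - box p n)
    rw [sub_sub_cancel] at this
    linarith
  have h3 := norm_sub_le (shift ℂ p n a) a
  rw [LinearIsometry.norm_map] at h3
  linarith

end Box

theorem le_of_forall_mul_le {a b K : ℝ} {v : ℕ → ℝ} (hv : Tendsto v atTop atTop)
    (h : ∀ n, v n * a ≤ v n * b + K) : a ≤ b := by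
  by_contra! hab
  have h1 : Tendsto (fun n => v n * (a - b)) atTop atTop :=
    hv.atTop_mul_const (sub_pos.2 hab)
  obtain ⟨n, hn⟩ := (h1.eventually_gt_atTop K).exists
  nlinarith [h n]

theorem exists_dual_of_not_dense {E : Type*} [NormedAddCommGroup E] [NormedSpace ℂ E]
    (K : Submodule ℂ E) (h : ¬Dense (K : Set E)) :
    ∃ f : E →L[ℂ] ℂ, (∀ x ∈ K, f x = 0) ∧ ∃ y, f y = 1 := by
  simp only [Dense, not_forall] at h
  obtain ⟨y, hy⟩ := h
  set K' := K.topologicalClosure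
  have : IsClosed (K' : Set E) := K.isClosed_topologicalClosure
  have hy0 : K'.mkQL y ≠ 0 := by
    intro h0
    exact hy ((Submodule.Quotient.mk_eq_zero K').1 h0)
  obtain ⟨g, -, hg⟩ := exists_dual_vector ℂ (K'.mkQL y) (norm_ne_zero_iff.2 hy0)
  refine ⟨g.comp K'.mkQL, fun x hx => ?_, (‖K'.mkQL y‖ : ℂ)⁻¹ • y, ?_⟩
  · have : K'.mkQL x = 0 := (Submodule.Quotient.mk_eq_zero K').2 (K.le_topologicalClosure hx)
    simp [this]
  · have hn : (‖K'.mkQL y‖ : ℂ) ≠ 0 := by exact_mod_cast norm_ne_zero_iff.2 hy0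
    rw [ContinuousLinearMap.comp_apply, map_smul, map_smul, hg, smul_eq_mul]
    exact inv_mul_cancel₀ hn

section Resolvent

variable {E : Type*} [NormedAddCommGroup E] [NormedSpace ℂ E] [CompleteSpace E]
  {p : ℝ≥0∞} [Fact (1 ≤ p)]

/-- Testing `Γ_ℝ` on the functions `∫₀ᵗ E_ℝ^r (1_[0,n) ⊗ x) dr` for large `n`. -/
theorem norm_integral_orbit_le_of_isInvertible (hp : p ≠ ∞) (T : C0Semigroup E)
    (h : IsInvertible (genLine p T)) (t : ℝ≥0) (x : E) :
    ‖∫ r in (0 : ℝ)..t, T.op r.toNNReal x‖ ≤ ‖inv (genLine p T)‖ * ‖T.op t x - x‖ := by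
  set c := ‖inv (genLine p T)‖ with hc
  obtain ⟨M, hM0, hM⟩ := T.exists_bound t
  set z := ∫ r in (0 : ℝ)..t, T.op r.toNNReal x with hz
  set b := ‖box p t‖ with hb
  have hb0 : 0 ≤ b := norm_nonneg _
  refine le_of_forall_mul_le (tendsto_norm_box (p := p) hp)
    (K := 2 * b * (M * ‖x‖) * t + c * (2 * b * (M * ‖x‖))) fun n => ?_
  set χ := box p (n : ℝ) with hχ
  have hsm : ∀ r : ℝ, 0 ≤ r → r ≤ t →
      ‖tensor (shift ℂ p r χ - χ) (T.op r.toNNReal x)‖ ≤ 2 * b * (M * ‖x‖) := by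
    intro r hr hrt
    rw [norm_tensor_apply]
    refine mul_le_mul (norm_shift_box_sub_le hp (Nat.cast_nonneg n) hr hrt)
      ((T.op _).le_of_opNorm_le (hM _ (Real.toNNReal_le_iff_le_coe.2 hrt)) x)
      (norm_nonneg _) (by positivity)
  set v : LpLine E p := ∫ r in (0 : ℝ)..t, evolLine p T r.toNNReal (tensor χ x) with hv
  have hg := (lineSemigroup hp T).integral_orbit_mem_graph t (tensor χ x)
  have hv1 : ‖v‖ ≤ c * ‖evolLine p T t (tensor χ x) - tensor χ x‖ := by
    have : v = inv (genLine p T) (evolLine p T t (tensor χ x) - tensor χ x) :=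
      (mem_graph_iff_eq_inv h).1 hg
    rw [this]
    exact ContinuousLinearMap.le_opNorm _ _
  have hΓ : ‖evolLine p T t (tensor χ x) - tensor χ x‖ ≤
      ‖χ‖ * ‖T.op t x - x‖ + 2 * b * (M * ‖x‖) := by
    have : evolLine p T t (tensor χ x) - tensor χ x =
        tensor χ (T.op t x - x) + tensor (shift ℂ p t χ - χ) (T.op t x) := by
      rw [evolLine_tensor, tensor_sub_left, map_sub]
      abel
    rw [this]
    refine (norm_add_le _ _).trans ?_
    rw [norm_tensor_apply]
    have := hsm t t.coe_nonneg le_rfl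
    rw [Real.toNNReal_coe] at this
    linarith
  have hcont1 : Continuous fun r : ℝ => evolLine p T r.toNNReal (tensor χ x) :=
    (lineSemigroup hp T).continuous_orbit (tensor χ x)
  have hcont2 : Continuous fun r : ℝ => (tensor χ (T.op r.toNNReal x) : LpLine E p) :=
    (tensor χ).continuous.comp (T.continuous_orbit x)
  -- Replacing the translates of `χ` by `χ` itself costs an error independent of `n`.
  have hdiff : ‖v - tensor χ z‖ ≤ 2 * b * (M * ‖x‖) * t := by
    have h1 : (tensor χ z : LpLine E p) = ∫ r in (0 : ℝ)..t, tensor χ (T.op r.toNNReal x) :=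
      (ContinuousLinearMap.intervalIntegral_comp_comm (tensor χ)
        ((T.continuous_orbit x).intervalIntegrable _ _)).symm
    rw [h1, hv, ← intervalIntegral.integral_sub (hcont1.intervalIntegrable _ _)
      (hcont2.intervalIntegrable _ _)]
    have := intervalIntegral.norm_integral_le_of_norm_le_const (a := (0 : ℝ)) (b := t)
      (f := fun r => evolLine p T r.toNNReal (tensor χ x) - tensor χ (T.op r.toNNReal x))
      (C := 2 * b * (M * ‖x‖)) (fun r hr => by
        rw [Set.uIoc_of_le t.coe_nonneg] at hr
        rw [evolLine_tensor, Real.coe_toNNReal r hr.1.le, ← tensor_sub_left]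
        exact hsm r hr.1.le hr.2)
    simpa using this
  have h3 : ‖χ‖ * ‖z‖ ≤ ‖v‖ + ‖v - tensor χ z‖ := by
    rw [← norm_tensor_apply]
    have := norm_sub_le v (v - tensor χ z)
    rwa [sub_sub_cancel] at this
  have h4 : c * ‖evolLine p T t (tensor χ x) - tensor χ x‖ ≤
      c * (‖χ‖ * ‖T.op t x - x‖ + 2 * b * (M * ‖x‖)) :=
    mul_le_mul_of_nonneg_left hΓ (norm_nonneg _)
  linarith

/-- The lower bound on `A`, from the bound on `∫₀ᵗ e^{rA} x dr` divided by `t` as `t → 0+`. -/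
theorem norm_le_of_mem_graph_of_isInvertible (hp : p ≠ ∞) (T : C0Semigroup E)
    (h : IsInvertible (genLine p T)) {x y : E} (hxy : (x, y) ∈ (generator T.op).graph) :
    ‖x‖ ≤ ‖inv (genLine p T)‖ * ‖y‖ := by
  have h1 : HasDerivAt (fun u : ℝ => ∫ r in (0 : ℝ)..u, T.op r.toNNReal x) x 0 := by
    have := ((T.continuous_orbit x).integral_hasStrictDerivAt 0 0).hasDerivAt
    simpa [T.op_zero_apply] using this
  have h1' := (hasDerivWithinAt_iff_tendsto_slope' (by simp)).1 (h1.hasDerivWithinAt (s := Set.Ioi 0))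
  have h2' := (hasDerivWithinAt_iff_tendsto_slope' (by simp)).1
    ((T.mem_graph_iff_hasDerivWithinAt x y).1 hxy)
  refine le_of_tendsto_of_tendsto h1'.norm (h2'.norm.const_mul _) ?_
  filter_upwards [self_mem_nhdsWithin] with t ht
  have ht' : (0 : ℝ) < t := ht
  have := norm_integral_orbit_le_of_isInvertible hp T h t.toNNReal x
  rw [Real.coe_toNNReal t ht'.le] at this
  simp only [slope, vsub_eq_sub, sub_zero, Real.toNNReal_zero, T.op_zero_apply,
    intervalIntegral.integral_same, norm_smul]
  rw [mul_left_comm]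
  exact mul_le_mul_of_nonneg_left this (norm_nonneg _)

/-- If the range of the generator were not dense, a functional vanishing on it would map `Γ_ℝ` to
the generator of the scalar translation semigroup, which is not surjective. -/
theorem dense_range_of_isInvertible (hp : p ≠ ∞) (T : C0Semigroup E)
    (h : IsInvertible (genLine p T)) :
    Dense {y | ∃ x, (x, y) ∈ (generator T.op).graph} := by
  by_contra hd
  have hK : {y | ∃ x, (x, y) ∈ (generator T.op).graph} =
      (((generator T.op).graph.map (LinearMap.snd ℂ E E) : Submodule ℂ E) : Set E) := by
    ext y
    simp
  rw [hK] at hd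
  obtain ⟨f, hf, y, hy⟩ := exists_dual_of_not_dense _ hd
  have hfT : ∀ (t : ℝ≥0), f.comp (T.op t) = f := by
    intro t
    ext x
    have := hf (T.op t x - x) ⟨_, T.integral_orbit_mem_graph t x, rfl⟩
    rw [map_sub, sub_eq_zero] at this
    exact this
  have hfE : ∀ (t : ℝ≥0) (g : LpLine E p),
      mulLine p f (evolLine p T t g) = shift ℂ p t (mulLine p f g) := by
    intro t g
    rw [evolLine_apply, mulLine_mulLine, hfT, mulLine_shift]
  set w : LpLine E p := tensor (box p 1) y with hw
  set u := inv (genLine p T) w with hu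
  have h1 := ((lineSemigroup hp T).mem_graph_iff_integral u w).1 (inv_mem_graph h w) 1
  refine shift_sub_ne_integral_box hp (mulLine p f u) ?_
  have h2 := congrArg (mulLine p f) h1
  rw [map_sub] at h2
  replace h2 := h2.trans (ContinuousLinearMap.intervalIntegral_comp_comm (mulLine p f)
    (((lineSemigroup hp T).continuous_orbit w).intervalIntegrable _ _)).symm
  have h3 : mulLine p f ((lineSemigroup hp T).op 1 u) = shift ℂ p 1 (mulLine p f u) := hfE 1 u
  rw [h3] at h2
  refine h2.trans (intervalIntegral.integral_congr fun r hr => ?_)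
  rw [NNReal.coe_one, Set.uIcc_of_le zero_le_one] at hr
  have h4 : mulLine p f ((lineSemigroup hp T).op r.toNNReal w) =
      shift ℂ p r.toNNReal (mulLine p f w) := hfE _ w
  have h5 : mulLine p f w = box p 1 := by
    rw [hw, mulLine_tensor, hy]
    refine Lp.ext ?_
    filter_upwards [tensor_coeFn (box p 1) (1 : ℂ)] with τ h
    rw [h, smul_eq_mul, mul_one]
  rw [h4, h5, Real.coe_toNNReal r hr.1]

theorem exists_isResolventAt_zero_of_isInvertible (hp : p ≠ ∞) (T : C0Semigroup E)
    (h : IsInvertible (genLine p T)) :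
    ∃ R, IsResolventAt (generator T.op) 0 R ∧ ‖R‖ ≤ ‖inv (genLine p T)‖ := by
  refine exists_isResolventAt_zero (norm_nonneg _) (fun x hx => ?_) fun y => ?_
  · simpa using norm_le_of_mem_graph_of_isInvertible hp T h hx
  · exact exists_preimage_of_dense T.isClosed_graph subset_rfl
      (fun q hq q' hq' => Submodule.sub_mem _ hq hq')
      (fun x y hxy => norm_le_of_mem_graph_of_isInvertible hp T h hxy)
      (dense_range_of_isInvertible hp T h) y

end Resolvent

/-! ### Rescaling and the resolvent on the imaginary axis -/

section Rescaling

variable {E : Type*} [NormedAddCommGroup E] [NormedSpace ℂ E]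
  {p : ℝ≥0∞} [Fact (1 ≤ p)]

/-- The rescaled semigroup `e^{-ist} e^{tA}`, whose generator is `A - is`. -/
noncomputable def rescale (T : C0Semigroup E) (s : ℝ) : C0Semigroup E where
  op t := Complex.exp (-(Complex.I * s * t)) • T.op t
  op_zero := by simp [T.op_zero]
  op_add t r := by
    ext x
    simp only [ContinuousLinearMap.comp_apply, smul_apply, map_smul, smul_smul, T.op_add_apply,
      ← Complex.exp_add]
    congr 2
    push_cast
    ring
  continuous_op x := by
    simp only [smul_apply]
    have := T.continuous_op x
    have h2 : Continuous fun t : ℝ≥0 => ((t : ℝ) : ℂ) :=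
      Complex.continuous_ofReal.comp NNReal.continuous_coe
    fun_prop

theorem rescale_op_apply (T : C0Semigroup E) (s : ℝ) (t : ℝ≥0) (x : E) :
    (rescale T s).op t x = Complex.exp (-(Complex.I * s * t)) • T.op t x := rfl

theorem rescale_rescale_neg (T : C0Semigroup E) (s : ℝ) (t : ℝ≥0) :
    (rescale (rescale T s) (-s)).op t = T.op t := by
  ext x
  rw [rescale_op_apply, rescale_op_apply, smul_smul, ← Complex.exp_add]
  simp

theorem mem_graph_rescale (T : C0Semigroup E) (s : ℝ) {x y : E}
    (h : (x, y + (Complex.I * s) • x) ∈ (generator T.op).graph) :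
    (x, y) ∈ (generator (rescale T s).op).graph := by
  rw [C0Semigroup.mem_graph_iff_hasDerivWithinAt] at h ⊢
  have h1 : HasDerivAt (fun r : ℝ => Complex.exp (-(Complex.I * s * r)))
      (-(Complex.I * s)) 0 := by
    have h2 : HasDerivAt (fun r : ℝ => -(Complex.I * s * (r : ℂ))) (-(Complex.I * s * 1)) 0 :=
      ((Complex.ofRealCLM.hasDerivAt).const_mul _).neg
    have := h2.cexp
    simpa using this
  have h3 := h1.hasDerivWithinAt.smul h
  have h4 : Complex.exp (-(Complex.I * s * ((0 : ℝ) : ℂ))) • (y + (Complex.I * s) • x) +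
      (-(Complex.I * s)) • T.op (Real.toNNReal 0) x = y := by
    simp [T.op_zero_apply]
  rw [h4] at h3
  refine h3.congr (fun r hr => ?_) ?_
  · rw [rescale_op_apply, Real.coe_toNNReal r (le_of_lt hr)]
    rfl
  · rw [rescale_op_apply, Real.coe_toNNReal 0 le_rfl]
    rfl

theorem mem_graph_rescale_iff (T : C0Semigroup E) (s : ℝ) (x y : E) :
    (x, y) ∈ (generator (rescale T s).op).graph ↔
      (x, y + (Complex.I * s) • x) ∈ (generator T.op).graph := by
  refine ⟨fun h => ?_, mem_graph_rescale T s⟩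
  have h1 : (x, (y + (Complex.I * s) • x) + (Complex.I * (-s : ℝ)) • x) ∈
      (generator (rescale T s).op).graph := by
    simpa using h
  have h2 := mem_graph_rescale (rescale T s) (-s) h1
  have h3 : (rescale (rescale T s) (-s)).op = T.op := funext (rescale_rescale_neg T s)
  rwa [h3] at h2

theorem isResolventAt_rescale_iff (T : C0Semigroup E) (s : ℝ) (R : E →L[ℂ] E) :
    IsResolventAt (generator (rescale T s).op) 0 R ↔
      IsResolventAt (generator T.op) (Complex.I * s) R := by
  rw [isResolventAt_zero_iff, isResolventAt_iff_graph]
  simp only [mem_graph_rescale_iff]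

theorem norm_exp_I_mul_mul (s τ : ℝ) : ‖Complex.exp (Complex.I * s * τ)‖ = 1 := by
  rw [mul_assoc, ← Complex.ofReal_mul, mul_comm, Complex.norm_exp_ofReal_mul_I]

omit [Fact (1 ≤ p)] in
theorem memLp_modulate (s : ℝ) (f : LpLine E p) :
    MemLp (fun τ : ℝ => Complex.exp (Complex.I * s * τ) • f τ) p volume := by
  refine (Lp.memLp f).of_le ?_ (Eventually.of_forall fun τ => ?_)
  · have : Continuous fun τ : ℝ => Complex.exp (Complex.I * s * τ) := by fun_prop
    exact this.aestronglyMeasurable.smul (Lp.aestronglyMeasurable f)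
  · rw [norm_smul, norm_exp_I_mul_mul, one_mul]

/-- Modulation `f ↦ e^{is·} f` on `L^p(ℝ, E)`. -/
noncomputable def modulate (s : ℝ) : LpLine E p →ₗᵢ[ℂ] LpLine E p where
  toFun f := (memLp_modulate s f).toLp _
  map_add' f g := by
    rw [← MemLp.toLp_add]
    refine MemLp.toLp_congr _ _ ?_
    filter_upwards [Lp.coeFn_add f g] with τ h
    rw [h, Pi.add_apply, smul_add, Pi.add_apply]
  map_smul' c f := by
    rw [RingHom.id_apply, ← MemLp.toLp_const_smul]
    refine MemLp.toLp_congr _ _ ?_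
    filter_upwards [Lp.coeFn_smul c f] with τ h
    rw [h, Pi.smul_apply, smul_comm, Pi.smul_apply]
  norm_map' f := by
    change ‖(memLp_modulate s f).toLp _‖ = ‖f‖
    rw [Lp.norm_toLp, Lp.norm_def]
    congr 1
    refine eLpNorm_congr_norm_ae (Eventually.of_forall fun τ => ?_)
    rw [norm_smul, norm_exp_I_mul_mul, one_mul]

theorem modulate_coeFn (s : ℝ) (f : LpLine E p) :
    modulate s f =ᵐ[volume] fun τ => Complex.exp (Complex.I * s * τ) • f τ :=
  MemLp.coeFn_toLp (memLp_modulate s f)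

theorem modulate_neg_modulate (s : ℝ) (f : LpLine E p) : modulate (-s) (modulate s f) = f := by
  refine Lp.ext ?_
  filter_upwards [modulate_coeFn (-s) (modulate s f), modulate_coeFn s f] with τ h1 h2
  rw [h1, h2, smul_smul, ← Complex.exp_add]
  simp

theorem modulate_modulate_neg (s : ℝ) (f : LpLine E p) : modulate s (modulate (-s) f) = f := by
  simpa using modulate_neg_modulate (-s) f

/-- Modulation conjugates the evolution semigroup into that of the rescaled semigroup. -/
theorem modulate_evolLine_rescale (T : C0Semigroup E) (s : ℝ) (t : ℝ≥0) (f : LpLine E p) :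
    modulate s (evolLine p (rescale T s) t f) = evolLine p T t (modulate s f) := by
  refine Lp.ext ?_
  filter_upwards [modulate_coeFn s (evolLine p (rescale T s) t f),
    evolLine_coeFn p (rescale T s) t f, evolLine_coeFn p T t (modulate s f),
    ae_comp_sub (modulate_coeFn s f) t] with τ h1 h2 h3 h4
  rw [h1, h2, h3, h4, rescale_op_apply, smul_smul, map_smul, ← Complex.exp_add]
  congr 2
  push_cast
  ring

theorem modulate_mem_graph_iff (T : C0Semigroup E) (s : ℝ) (f g : LpLine E p) :
    (modulate s f, modulate s g) ∈ (genLine p T).graph ↔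
      (f, g) ∈ (genLine p (rescale T s)).graph := by
  constructor
  · intro h
    have := generator_graph_map (S' := evolLine p (rescale T s))
      (modulate (E := E) (p := p) (-s)).toContinuousLinearMap (fun t x => ?_) h
    · simp only [LinearIsometry.coe_toContinuousLinearMap, modulate_neg_modulate] at this
      exact this
    · simp only [LinearIsometry.coe_toContinuousLinearMap]
      apply (modulate s).injective
      rw [modulate_modulate_neg, modulate_evolLine_rescale, modulate_modulate_neg]
  · exact generator_graph_map (S := evolLine p (rescale T s)) (S' := evolLine p T)
      (modulate (E := E) (p := p) s).toContinuousLinearMap (modulate_evolLine_rescale T s)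

theorem exists_isResolventAt_genLine_rescale (T : C0Semigroup E) (s : ℝ)
    (h : IsInvertible (genLine p T)) :
    ∃ R, IsResolventAt (genLine p (rescale T s)) 0 R ∧ ‖R‖ ≤ ‖inv (genLine p T)‖ := by
  refine ⟨((modulate (-s)).toContinuousLinearMap.comp (inv (genLine p T))).comp
    (modulate s).toContinuousLinearMap, isResolventAt_zero_iff.2 fun x y => ?_, ?_⟩
  · rw [← modulate_mem_graph_iff, mem_graph_iff_eq_inv h]
    simp only [ContinuousLinearMap.comp_apply, LinearIsometry.coe_toContinuousLinearMap]
    constructor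
    · intro h1
      rw [← h1, modulate_neg_modulate]
    · rintro rfl
      rw [modulate_modulate_neg]
  · refine ContinuousLinearMap.opNorm_le_bound _ (norm_nonneg _) fun f => ?_
    simp only [ContinuousLinearMap.comp_apply, LinearIsometry.coe_toContinuousLinearMap,
      LinearIsometry.norm_map]
    refine (ContinuousLinearMap.le_opNorm _ _).trans ?_
    rw [LinearIsometry.norm_map]

variable [CompleteSpace E]

/-- Invertibility of `Γ_ℝ` gives a uniformly bounded resolvent of `A` on the imaginary axis. -/
theorem exists_isResolventAt_imaginary (hp : p ≠ ∞) (T : C0Semigroup E)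
    (h : IsInvertible (genLine p T)) (s : ℝ) :
    ∃ R, IsResolventAt (generator T.op) (Complex.I * s) R ∧ ‖R‖ ≤ ‖inv (genLine p T)‖ := by
  obtain ⟨R₁, hR₁, hn₁⟩ := exists_isResolventAt_genLine_rescale T s h
  obtain ⟨R, hR, hn⟩ := exists_isResolventAt_zero_of_isInvertible hp (rescale T s) ⟨R₁, hR₁⟩
  refine ⟨R, (isResolventAt_rescale_iff T s R).1 hR, hn.trans ?_⟩
  have : inv (genLine p (rescale T s)) = R₁ := res_eq hR₁
  rwa [this]

/-- The integrated form of `(A - is) R = 1`. -/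
theorem exp_smul_op_sub_res (T : C0Semigroup E) {s : ℝ} {R : E →L[ℂ] E}
    (hR : IsResolventAt (generator T.op) (Complex.I * s) R) (t : ℝ≥0) (x : E) :
    Complex.exp (-(Complex.I * s * t)) • T.op t (R x) - R x =
      ∫ r in (0 : ℝ)..t, Complex.exp (-(Complex.I * s * r)) • T.op r.toNNReal x := by
  have h1 := isResolventAt_zero_iff.1 ((isResolventAt_rescale_iff T s R).2 hR)
  have h2 := ((rescale T s).mem_graph_iff_integral (R x) x).1 ((h1 _ _).2 rfl) t
  rw [rescale_op_apply] at h2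
  refine h2.trans (intervalIntegral.integral_congr fun r hr => ?_)
  rw [Set.uIcc_of_le t.coe_nonneg] at hr
  simp only [rescale_op_apply, Real.coe_toNNReal r hr.1]

end Rescaling

/-! ### Smoothness of the resolvent and Fourier integrals of Schwartz functions -/

section ResolventSmooth

variable {E : Type*} [NormedAddCommGroup E] [NormedSpace ℂ E]

/-- The resolvent identity. -/
theorem resolvent_sub {A : E →ₗ.[ℂ] E} {z w : ℂ} {R S : E →L[ℂ] E} (hR : IsResolventAt A z R)
    (hS : IsResolventAt A w S) : R - S = (z - w) • (R * S) := by
  ext y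
  have h1 := (isResolventAt_iff_graph.1 hS (S y) y).2 rfl
  have h2 : (S y, (y + (w - z) • S y) + z • S y) ∈ A.graph := by
    convert h1 using 2
    rw [sub_smul]
    abel
  have h3 := (isResolventAt_iff_graph.1 hR _ _).1 h2
  rw [map_add, map_smul] at h3
  simp only [sub_apply, smul_apply, mul_apply_eq_comp]
  nth_rw 1 [h3]
  rw [sub_smul, sub_smul]
  abel

variable {A : E →ₗ.[ℂ] E} {R : ℝ → E →L[ℂ] E} {c : ℝ}

theorem hasDerivAt_resolvent (hR : ∀ s : ℝ, IsResolventAt A (Complex.I * s) (R s))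
    (hc : ∀ s, ‖R s‖ ≤ c) (s : ℝ) : HasDerivAt R (Complex.I • (R s * R s)) s := by
  have hc0 : 0 ≤ c := (norm_nonneg _).trans (hc 0)
  have hsub : ∀ t : ℝ, R t - R s = (Complex.I * (t - s : ℝ)) • (R t * R s) := by
    intro t
    rw [resolvent_sub (hR t) (hR s)]
    push_cast
    rw [mul_sub]
  have hcont : Tendsto R (𝓝 s) (𝓝 (R s)) := by
    rw [tendsto_iff_norm_sub_tendsto_zero]
    have h0 : Tendsto (fun t => |t - s| * (c * c)) (𝓝 s) (𝓝 0) := by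
      have : Continuous fun t : ℝ => |t - s| * (c * c) := by fun_prop
      simpa using this.tendsto s
    refine squeeze_zero (fun _ => norm_nonneg _) (fun t => ?_) h0
    rw [hsub, norm_smul, norm_mul, Complex.norm_I, one_mul, Complex.norm_real, Real.norm_eq_abs]
    gcongr
    exact (norm_mul_le _ _).trans (mul_le_mul (hc t) (hc s) (norm_nonneg _) hc0)
  rw [hasDerivAt_iff_tendsto_slope]
  have h1 : Tendsto (fun t => Complex.I • (R t * R s)) (𝓝[≠] s) (𝓝 (Complex.I • (R s * R s))) :=
    ((hcont.mul_const _).const_smul _).mono_left nhdsWithin_le_nhds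
  refine h1.congr' ?_
  filter_upwards [self_mem_nhdsWithin] with t ht
  have ht' : t - s ≠ 0 := sub_ne_zero.2 ht
  rw [slope, vsub_eq_sub, hsub, ← Complex.coe_smul, smul_smul]
  congr 1
  have : ((t - s : ℝ) : ℂ) ≠ 0 := by exact_mod_cast ht'
  push_cast at this ⊢
  field_simp

theorem hasDerivAt_resolvent_pow (hR : ∀ s : ℝ, IsResolventAt A (Complex.I * s) (R s))
    (hc : ∀ s, ‖R s‖ ≤ c) (n : ℕ) (s : ℝ) :
    HasDerivAt (fun s => R s ^ (n + 1)) (((n + 1 : ℕ) * Complex.I) • R s ^ (n + 2)) s := by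
  induction n with
  | zero => simpa [pow_two] using hasDerivAt_resolvent hR hc s
  | succ n ih =>
    have := ih.mul (hasDerivAt_resolvent hR hc s)
    have h2 : ((((n + 1 : ℕ) * Complex.I) • R s ^ (n + 2)) * R s +
        R s ^ (n + 1) * (Complex.I • (R s * R s))) =
        ((n + 1 + 1 : ℕ) * Complex.I) • R s ^ (n + 1 + 2) := by
      rw [smul_mul_assoc, mul_smul_comm, ← pow_succ, ← pow_two, ← pow_add, ← add_smul]
      congr 1
      push_cast
      ring
    rw [h2] at this
    exact this

theorem iteratedDeriv_resolvent (hR : ∀ s : ℝ, IsResolventAt A (Complex.I * s) (R s))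
    (hc : ∀ s, ‖R s‖ ≤ c) (n : ℕ) :
    iteratedDeriv n R = fun s => ((n.factorial : ℂ) * Complex.I ^ n) • R s ^ (n + 1) := by
  induction n with
  | zero => ext1 s; simp
  | succ n ih =>
    rw [iteratedDeriv_succ, ih]
    ext1 s
    have := (hasDerivAt_resolvent_pow hR hc n s).const_smul ((n.factorial : ℂ) * Complex.I ^ n)
    refine this.deriv.trans ?_
    rw [smul_smul, Nat.factorial_succ]
    congr 1
    push_cast
    ring

theorem hasTemperateGrowth_resolvent (hR : ∀ s : ℝ, IsResolventAt A (Complex.I * s) (R s))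
    (hc : ∀ s, ‖R s‖ ≤ c) : Function.HasTemperateGrowth R := by
  refine ⟨contDiff_of_differentiable_iteratedDeriv fun n _ => ?_, fun n => ?_⟩
  · rw [iteratedDeriv_resolvent hR hc]
    intro s
    exact ((hasDerivAt_resolvent_pow hR hc n s).const_smul
      ((n.factorial : ℂ) * Complex.I ^ n)).differentiableAt
  · refine ⟨0, n.factorial * c ^ (n + 1), fun s => ?_⟩
    rw [norm_iteratedFDeriv_eq_norm_iteratedDeriv, iteratedDeriv_resolvent hR hc, norm_smul,
      norm_mul, norm_pow, Complex.norm_I, one_pow, mul_one, Complex.norm_natCast, pow_zero, mul_one]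
    gcongr
    exact (norm_pow_le' _ (Nat.succ_pos n)).trans (pow_le_pow_left₀ (norm_nonneg _) (hc s) _)

end ResolventSmooth

section FourierIntegral

variable {E F : Type*} [NormedAddCommGroup E] [NormedSpace ℂ E]
  [NormedAddCommGroup F] [NormedSpace ℂ F]

theorem integrable_exp_smul {v : ℝ → E} (hv : Integrable v) (τ : ℝ) :
    Integrable fun s : ℝ => Complex.exp (Complex.I * s * τ) • v s := by
  have hc : Continuous fun s : ℝ => Complex.exp (Complex.I * s * τ) := by fun_prop
  refine hv.mono (hc.aestronglyMeasurable.smul hv.1) (Eventually.of_forall fun s => ?_)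
  rw [norm_smul, norm_exp_I_mul_mul, one_mul]

/-- The dilation of the line by `(2π)⁻¹`. -/
noncomputable def dilation : ℝ ≃L[ℝ] ℝ :=
  ContinuousLinearEquiv.unitsEquivAut ℝ (Units.mk0 ((2 * Real.pi)⁻¹)
    (inv_ne_zero Real.two_pi_pos.ne'))

theorem dilation_apply (τ : ℝ) : dilation τ = τ * (2 * Real.pi)⁻¹ := rfl

/-- The function `τ ↦ ∫ v(s) e^{isτ} ds` for a Schwartz function `v`, as a Schwartz function: a
rescaled inverse Fourier transform. -/
noncomputable def expSchwartz (v : 𝓢(ℝ, E)) : 𝓢(ℝ, E) :=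
  SchwartzMap.compCLMOfContinuousLinearEquiv ℂ dilation (FourierTransformInv.fourierInv v)

theorem expSchwartz_coe (v : 𝓢(ℝ, E)) : ⇑(expSchwartz v) = expIntegral v := by
  ext τ
  have h : expSchwartz v τ = FourierTransformInv.fourierInv (v : ℝ → E) (dilation τ) := by
    rw [← SchwartzMap.fourierInv_coe]
    rfl
  rw [h, Real.fourierInv_eq', expIntegral]
  refine integral_congr_ae (Eventually.of_forall fun s => ?_)
  simp only [dilation_apply]
  congr 2
  have : (Real.pi : ℂ) ≠ 0 := by exact_mod_cast Real.pi_ne_zero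
  simp only [RCLike.inner_apply, conj_trivial]
  push_cast
  field_simp

variable [CompleteSpace E] [CompleteSpace F]

theorem expSchwartz_surjective : Function.Surjective (expSchwartz (E := E)) := by
  intro f
  refine ⟨FourierTransform.fourier
    (SchwartzMap.compCLMOfContinuousLinearEquiv ℂ dilation.symm f), ?_⟩
  rw [expSchwartz, FourierTransform.fourierInv_fourier_eq]
  ext τ
  simp

theorem expSchwartz_ne_zero {v : 𝓢(ℝ, E)} (hv : v ≠ 0) : expSchwartz v ≠ 0 := by
  contrapose! hv
  have h1 : (FourierTransformInv.fourierInv v : 𝓢(ℝ, E)) = 0 := by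
    ext τ
    have := DFunLike.congr_fun hv (dilation.symm τ)
    simpa [expSchwartz] using this
  have h2 : (FourierTransform.fourier (FourierTransformInv.fourierInv v : 𝓢(ℝ, E)) : 𝓢(ℝ, E)) = v :=
    FourierTransform.fourier_fourierInv_eq v
  rw [← h2, h1]
  exact map_zero (SchwartzMap.fourierTransformCLM ℂ)

theorem expIntegral_clm (L : E →L[ℂ] F) {v : ℝ → E} (hv : Integrable v) (τ : ℝ) :
    expIntegral (fun s => L (v s)) τ = L (expIntegral v τ) := by
  rw [expIntegral, expIntegral, ← L.integral_comp_comm (integrable_exp_smul hv τ)]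
  simp

theorem mulLine_expSchwartz_toLp (p : ℝ≥0∞) [Fact (1 ≤ p)] (L : E →L[ℂ] F) (v : 𝓢(ℝ, E)) :
    mulLine p L ((expSchwartz v).toLp p) = (expSchwartz (v.postcompCLM L)).toLp p := by
  refine Lp.ext ?_
  filter_upwards [mulLine_coeFn L ((expSchwartz v).toLp p),
    (expSchwartz v).coeFn_toLp p, (expSchwartz (v.postcompCLM L)).coeFn_toLp p] with τ h1 h2 h3
  rw [h1, h2, h3, expSchwartz_coe, expSchwartz_coe, ← expIntegral_clm L v.integrable]
  rfl

/-- The pointwise product `s ↦ R(s) v(s)` of an operator-valued function of temperate growth and a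
Schwartz function. -/
noncomputable def opMul {R : ℝ → E →L[ℂ] F} (hR : Function.HasTemperateGrowth R) (v : 𝓢(ℝ, E)) :
    𝓢(ℝ, F) :=
  SchwartzMap.bilinLeftCLM (ContinuousLinearMap.apply ℂ F) hR v

end FourierIntegral

/-! ### The evolution generator as a Fourier multiplier -/

section SymbolFormula

variable {E : Type*} [NormedAddCommGroup E] [NormedSpace ℂ E] [CompleteSpace E]

/-- Integrated form of `Γ_ℝ e^{is·} x = e^{is·} (A - is) x`, superposed over `s`. -/
theorem op_expIntegral_sub (T : C0Semigroup E) {R : ℝ → E →L[ℂ] E}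
    (hR : ∀ s : ℝ, IsResolventAt (generator T.op) (Complex.I * s) (R s)) {v : ℝ → E}
    (hv : Integrable v) (hvc : Continuous v) (hRv : Integrable fun s => R s (v s)) (t : ℝ≥0)
    (τ : ℝ) :
    T.op t (expIntegral (fun s => R s (v s)) (τ - t)) - expIntegral (fun s => R s (v s)) τ =
      ∫ r in (0 : ℝ)..t, T.op r.toNNReal (expIntegral v (τ - r)) := by
  obtain ⟨M, hM0, hM⟩ := T.exists_bound t
  set k : ℝ → ℝ → E := fun s r =>
    Complex.exp (Complex.I * s * (τ - r : ℝ)) • T.op r.toNNReal (v s) with hk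
  have hkc : Continuous (Function.uncurry k) := by
    have h1 : Continuous fun q : ℝ × ℝ => T.op q.2.toNNReal (v q.1) :=
      T.continuous_uncurry.comp ((continuous_real_toNNReal.comp continuous_snd).prodMk
        (hvc.comp continuous_fst))
    have h2 : Continuous fun q : ℝ × ℝ => Complex.exp (Complex.I * q.1 * (τ - q.2 : ℝ)) := by
      fun_prop
    exact h2.smul h1
  have hint : Integrable (Function.uncurry k)
      ((volume : Measure ℝ).prod (volume.restrict (Set.Ioc (0 : ℝ) t))) := by
    have hb : Integrable (fun q : ℝ × ℝ => M * ‖v q.1‖)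
        ((volume : Measure ℝ).prod (volume.restrict (Set.Ioc (0 : ℝ) t))) :=
      (hv.norm.comp_fst _).const_mul M
    refine hb.mono' hkc.aestronglyMeasurable ?_
    have hae : ∀ᵐ q ∂((volume : Measure ℝ).prod (volume.restrict (Set.Ioc (0 : ℝ) t))),
        q.2 ∈ Set.Ioc (0 : ℝ) t :=
      Measure.quasiMeasurePreserving_snd.ae (ae_restrict_mem measurableSet_Ioc)
    filter_upwards [hae] with q hq
    rw [Function.uncurry, hk]
    simp only
    rw [norm_smul, norm_exp_I_mul_mul, one_mul]
    exact (T.op _).le_of_opNorm_le (hM _ (Real.toNNReal_le_iff_le_coe.2 hq.2)) _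
  have hswap := integral_integral_swap hint
  have hright : ∀ r : ℝ, ∫ s, k s r = T.op r.toNNReal (expIntegral v (τ - r)) := by
    intro r
    rw [expIntegral, ← (T.op r.toNNReal).integral_comp_comm (integrable_exp_smul hv _)]
    simp [hk]
  have hleft : ∀ s : ℝ, ∫ r in Set.Ioc (0 : ℝ) t, k s r =
      T.op t (Complex.exp (Complex.I * s * (τ - t : ℝ)) • R s (v s)) -
        Complex.exp (Complex.I * s * τ) • R s (v s) := by
    intro s
    have h1 := exp_smul_op_sub_res T (hR s) t (v s)
    rw [intervalIntegral.integral_of_le t.coe_nonneg] at h1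
    have h2 := congrArg (fun y => Complex.exp (Complex.I * s * τ) • y) h1
    simp only [smul_sub, smul_smul, ← Complex.exp_add] at h2
    rw [← integral_smul] at h2
    have h3 : ∀ r : ℝ, Complex.exp (Complex.I * s * τ) •
        (Complex.exp (-(Complex.I * s * r)) • T.op r.toNNReal (v s)) = k s r := by
      intro r
      rw [smul_smul, ← Complex.exp_add, hk]
      congr 2
      push_cast
      ring
    simp only [h3] at h2
    rw [← h2, map_smul]
    congr 3
    push_cast
    ring
  simp only [hright, hleft] at hswap
  rw [intervalIntegral.integral_of_le t.coe_nonneg, ← hswap, integral_sub]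
  · rw [(T.op t).integral_comp_comm (integrable_exp_smul hRv _)]
    rfl
  · exact (T.op t).integrable_comp (integrable_exp_smul hRv _)
  · exact integrable_exp_smul hRv _

variable {p : ℝ≥0∞} [Fact (1 ≤ p)]

theorem expSchwartz_mem_graph_genLine (hp : p ≠ ∞) (T : C0Semigroup E) {R : ℝ → E →L[ℂ] E}
    (hR : ∀ s : ℝ, IsResolventAt (generator T.op) (Complex.I * s) (R s))
    (hRt : Function.HasTemperateGrowth R) (v : 𝓢(ℝ, E)) :
    ((expSchwartz (opMul hRt v)).toLp p volume, (expSchwartz v).toLp p volume) ∈ (genLine p T).graph := by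
  rw [mem_graph_genLine_iff hp]
  intro t
  have hu := (expSchwartz (opMul hRt v)).coeFn_toLp p volume
  have hg := (expSchwartz v).coeFn_toLp p volume
  filter_upwards [hu, ae_comp_sub hu t] with τ h1 h2
  rw [h1, h2, expSchwartz_coe]
  refine (op_expIntegral_sub T hR v.integrable v.continuous (opMul hRt v).integrable t τ).trans ?_
  refine intervalIntegral.integral_congr_ae ?_
  have h3 : ∀ᵐ r : ℝ, ((expSchwartz v).toLp p volume : LpLine E p) (τ - r) = expSchwartz v (τ - r) :=
    (Measure.measurePreserving_sub_left volume τ).quasiMeasurePreserving.ae hg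
  filter_upwards [h3] with r h4 _
  rw [h4, expSchwartz_coe]

end SymbolFormula

/-- The operator norm is the supremum of the quotients `‖L x‖ / ‖x‖` over the nonzero vectors of a
dense family. -/
theorem enorm_eq_iSup_of_denseRange {ι E F : Type*} [NormedAddCommGroup E] [NormedSpace ℂ E]
    [NormedAddCommGroup F] [NormedSpace ℂ F] {φ : ι → E} (hφ : DenseRange φ) (L : E →L[ℂ] F) :
    ‖L‖ₑ = ⨆ i : {i // φ i ≠ 0}, ‖L (φ i)‖ₑ / ‖φ i‖ₑ := by
  refine le_antisymm ?_ (iSup_le fun i => ENNReal.div_le_of_le_mul (L.le_opENorm _))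
  set K := ⨆ i : {i // φ i ≠ 0}, ‖L (φ i)‖ₑ / ‖φ i‖ₑ with hK
  by_cases hT : K = ∞
  · rw [hT]; exact le_top
  lift K to ℝ≥0 using hT with k
  have hmain : ∀ x, ‖L x‖ ≤ k * ‖x‖ := by
    intro x
    have hcl : IsClosed {x | ‖L x‖ ≤ k * ‖x‖} := isClosed_le (by fun_prop) (by fun_prop)
    refine hφ.induction_on x hcl fun i => ?_
    by_cases hi : φ i = 0
    · simp [hi]
    · have h1 : ‖L (φ i)‖ₑ / ‖φ i‖ₑ ≤ k := by
        rw [hK]; exact le_iSup (fun i : {i // φ i ≠ 0} => ‖L (φ i)‖ₑ / ‖φ i‖ₑ) ⟨i, hi⟩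
      rw [ENNReal.div_le_iff (by simpa using hi) enorm_ne_top] at h1
      have h2 : ‖L (φ i)‖₊ ≤ k * ‖φ i‖₊ := by
        rw [enorm_eq_nnnorm, enorm_eq_nnnorm] at h1
        exact_mod_cast h1
      exact_mod_cast h2
  have h3 : ‖L‖₊ ≤ k := L.opNorm_le_bound k.2 hmain
  rw [enorm_eq_nnnorm]
  exact_mod_cast h3

section LineFormula

variable {X U Y : Type*} [NormedAddCommGroup X] [NormedSpace ℂ X] [CompleteSpace X]
    [NormedAddCommGroup U] [NormedSpace ℂ U] [CompleteSpace U]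
    [NormedAddCommGroup Y] [NormedSpace ℂ Y] [CompleteSpace Y]
    {p : ℝ≥0∞} [Fact (1 ≤ p)]

omit [CompleteSpace U] [CompleteSpace Y] in
theorem hasTemperateGrowth_res (hp : p ≠ ∞) (T : C0Semigroup X)
    (h : IsInvertible (genLine p T)) :
    (∀ s : ℝ, IsResolventAt (generator T.op) (Complex.I * s) (res (generator T.op) (Complex.I * s))) ∧
      Function.HasTemperateGrowth fun s : ℝ => res (generator T.op) (Complex.I * s) := by
  have h1 : ∀ s : ℝ, IsResolventAt (generator T.op) (Complex.I * s)
      (res (generator T.op) (Complex.I * s)) := fun s => by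
    obtain ⟨R, hR, -⟩ := exists_isResolventAt_imaginary hp T h s
    exact isResolventAt_res ⟨R, hR⟩
  refine ⟨h1, hasTemperateGrowth_resolvent h1 (c := ‖inv (genLine p T)‖) fun s => ?_⟩
  obtain ⟨R, hR, hn⟩ := exists_isResolventAt_imaginary hp T h s
  rwa [res_eq hR]

/-- The Schwartz function `s ↦ C (A - is)⁻¹ B u(s)`. -/
noncomputable def transferSchwartz (T : C0Semigroup X) (B : U →L[ℂ] X) (C : X →L[ℂ] Y)
    (hR : Function.HasTemperateGrowth fun s : ℝ => res (generator T.op) (Complex.I * s))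
    (u : 𝓢(ℝ, U)) : 𝓢(ℝ, Y) :=
  (opMul hR (u.postcompCLM B)).postcompCLM C

omit [CompleteSpace X] [CompleteSpace U] [CompleteSpace Y] in
theorem transferSchwartz_coe (T : C0Semigroup X) (B : U →L[ℂ] X) (C : X →L[ℂ] Y)
    (hR : Function.HasTemperateGrowth fun s : ℝ => res (generator T.op) (Complex.I * s))
    (u : 𝓢(ℝ, U)) : ⇑(transferSchwartz T B C hR u) = fun s => transfer T B C s (u s) := rfl

/-- On the functions `∫ u(s) e^{is·} ds` the operator `𝓒 Γ_ℝ⁻¹ 𝓑` acts as the Fourier multiplier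
with symbol `C (A - is)⁻¹ B`. -/
theorem sysLine_expSchwartz (hp : p ≠ ∞) (T : C0Semigroup X) (B : U →L[ℂ] X) (C : X →L[ℂ] Y)
    (h : IsInvertible (genLine p T))
    (hR : Function.HasTemperateGrowth fun s : ℝ => res (generator T.op) (Complex.I * s))
    (u : 𝓢(ℝ, U)) :
    sysLine p T B C ((expSchwartz u).toLp p) = (expSchwartz (transferSchwartz T B C hR u)).toLp p := by
  have h1 := expSchwartz_mem_graph_genLine hp T (hasTemperateGrowth_res hp T h).1 hR
    (u.postcompCLM B)
  rw [mem_graph_iff_eq_inv h] at h1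
  rw [sysLine, ContinuousLinearMap.comp_apply, ContinuousLinearMap.comp_apply,
    mulLine_expSchwartz_toLp, ← h1, mulLine_expSchwartz_toLp]
  rfl

theorem denseRange_expSchwartz_toLp (hp : p ≠ ∞) :
    DenseRange fun u : 𝓢(ℝ, U) => (expSchwartz u).toLp p (volume : Measure ℝ) :=
  (SchwartzMap.denseRange_toLpCLM (F := U) (μ := (volume : Measure ℝ)) hp).comp
    expSchwartz_surjective.denseRange (SchwartzMap.toLpCLM ℝ U p volume).continuous

omit [CompleteSpace U] in
theorem enorm_toLp_expSchwartz (u : 𝓢(ℝ, U)) :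
    ‖(expSchwartz u).toLp p (volume : Measure ℝ)‖ₑ = eLpNorm (expIntegral u) p volume := by
  rw [Lp.enorm_def, eLpNorm_congr_ae ((expSchwartz u).coeFn_toLp p volume), expSchwartz_coe]

theorem toLp_expSchwartz_eq_zero_iff (u : 𝓢(ℝ, U)) :
    (expSchwartz u).toLp p (volume : Measure ℝ) = 0 ↔ u = 0 := by
  constructor
  · intro h
    by_contra hu
    refine expSchwartz_ne_zero hu (SchwartzMap.injective_toLp p volume ?_)
    exact h.trans (map_zero (SchwartzMap.toLpCLM ℝ U p volume)).symm
  · rintro rfl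
    have : expSchwartz (0 : 𝓢(ℝ, U)) = 0 := by
      ext τ
      rw [expSchwartz_coe]
      simp [expIntegral]
    rw [this]
    exact map_zero (SchwartzMap.toLpCLM ℝ U p volume)

theorem enorm_sysLine_eq_iSup (hp : p ≠ ∞) (T : C0Semigroup X) (B : U →L[ℂ] X) (C : X →L[ℂ] Y)
    (h : IsInvertible (genLine p T)) :
    ‖sysLine p T B C‖ₑ = ⨆ u : {u : 𝓢(ℝ, U) // u ≠ 0},
      eLpNorm (expIntegral fun s => transfer T B C s (u.1 s)) p volume /
        eLpNorm (expIntegral fun s => u.1 s) p volume := by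
  have hR := (hasTemperateGrowth_res hp T h).2
  rw [enorm_eq_iSup_of_denseRange (denseRange_expSchwartz_toLp (U := U) hp)]
  refine Equiv.iSup_congr (Equiv.subtypeEquivRight fun u =>
    not_congr (toLp_expSchwartz_eq_zero_iff u)) fun u => ?_
  rw [sysLine_expSchwartz hp T B C h hR, enorm_toLp_expSchwartz, enorm_toLp_expSchwartz,
    transferSchwartz_coe]
  rfl

end LineFormula

/-! ### The half-line -/

section Truncation

variable {E : Type*} [NormedAddCommGroup E] [NormedSpace ℂ E] {p : ℝ≥0∞} [Fact (1 ≤ p)]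

/-- The embedding of `L^p(ℝ₊, E)` into `L^p(ℝ, E)` as the space of functions supported in
`[a, ∞)`. -/
noncomputable def embedFrom (a : ℝ) : LpHalf E p →ₗᵢ[ℂ] LpLine E p :=
  (shift E p a).comp (extendZero E p)

/-- The part of a function on `[a, ∞)`, as a function on the half-line. -/
noncomputable def partFrom (a : ℝ) : LpLine E p →L[ℂ] LpHalf E p :=
  (restrictHalf E p).comp (shift E p (-a)).toContinuousLinearMap

/-- Multiplication by the indicator function of `[a, ∞)`. -/
noncomputable def truncFrom (a : ℝ) : LpLine E p →L[ℂ] LpLine E p :=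
  (embedFrom a).toContinuousLinearMap.comp (partFrom a)

theorem truncFrom_apply (a : ℝ) (f : LpLine E p) :
    truncFrom a f = embedFrom a (partFrom a f) := rfl

theorem partFrom_embedFrom (a : ℝ) (g : LpHalf E p) : partFrom a (embedFrom a g) = g := by
  change restrictHalf E p (shift E p (-a) (shift E p a (extendZero E p g))) = g
  rw [shift_shift, neg_add_cancel, shift_zero, restrictHalf_extendZero]

theorem truncFrom_embedFrom (a : ℝ) (g : LpHalf E p) :
    truncFrom a (embedFrom a g) = embedFrom a g := by
  rw [truncFrom_apply, partFrom_embedFrom]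

theorem truncFrom_coeFn (a : ℝ) (f : LpLine E p) :
    truncFrom a f =ᵐ[volume] (Set.Ici a).indicator f := by
  have h1 := shift_coeFn a (extendZero E p (restrictHalf E p (shift E p (-a) f)))
  have h2 := ae_comp_sub (extendZero_restrictHalf_coeFn (shift E p (-a) f)) a
  have h3 := ae_comp_sub (shift_coeFn (-a) f) a
  filter_upwards [h1, h2, h3] with τ h1 h2 h3
  refine (h1.trans h2).trans ?_
  simp only [Set.indicator_apply, Set.mem_Ici, sub_nonneg, h3]
  simp

theorem norm_partFrom_le (a : ℝ) (f : LpLine E p) : ‖partFrom a f‖ ≤ ‖f‖ := by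
  change ‖restrictHalf E p (shift E p (-a) f)‖ ≤ ‖f‖
  rw [← (extendZero E p).norm_map]
  exact (norm_extendZero_restrictHalf_le _).trans_eq (LinearIsometry.norm_map _ _)

theorem norm_truncFrom_le (a : ℝ) (f : LpLine E p) : ‖truncFrom a f‖ ≤ ‖f‖ := by
  rw [truncFrom_apply, LinearIsometry.norm_map]
  exact norm_partFrom_le a f

theorem truncFrom_truncFrom {a b : ℝ} (hab : b ≤ a) (f : LpLine E p) :
    truncFrom b (truncFrom a f) = truncFrom a f := by
  refine Lp.ext ?_
  filter_upwards [truncFrom_coeFn b (truncFrom a f), truncFrom_coeFn a f] with τ h1 h2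
  rw [h1]
  by_cases hb : τ ∈ Set.Ici b
  · rw [Set.indicator_of_mem hb]
  · rw [Set.indicator_of_notMem hb, h2, Set.indicator_of_notMem]
    exact fun h => hb (hab.trans h)

theorem truncFrom_of_le {a b : ℝ} (hab : b ≤ a) {f : LpLine E p} (hf : truncFrom a f = f) :
    truncFrom b f = f := by
  rw [← hf, truncFrom_truncFrom hab]

theorem tendsto_truncFrom (hp : p ≠ ∞) (f : LpLine E p) :
    Tendsto (fun n : ℕ => truncFrom (-(n : ℝ)) f) atTop (𝓝 f) := by
  rw [Metric.tendsto_atTop]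
  intro ε hε
  obtain ⟨g, hgs, hfg, -, hg⟩ := (Lp.memLp f).exists_hasCompactSupport_eLpNorm_sub_le hp
    (ε := ENNReal.ofReal (ε / 3)) (by simpa using hε)
  have hd : ‖f - hg.toLp g‖ ≤ ε / 3 := by
    have h1 : f - hg.toLp g = ((Lp.memLp f).sub hg).toLp _ := by
      rw [MemLp.toLp_sub (Lp.memLp f) hg, Lp.toLp_coeFn]
    rw [h1, Lp.norm_toLp]
    exact ENNReal.toReal_le_of_le_ofReal (by positivity) hfg
  obtain ⟨m, hm⟩ := hgs.isCompact.isBounded.subset_closedBall 0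
  obtain ⟨N, hN⟩ := exists_nat_ge m
  refine ⟨N, fun n hn => ?_⟩
  have hgn : truncFrom (-(n : ℝ)) (hg.toLp g) = hg.toLp g := by
    refine Lp.ext ?_
    filter_upwards [truncFrom_coeFn (-(n : ℝ)) (hg.toLp g), hg.coeFn_toLp] with τ h1 h2
    rw [h1]
    by_cases hτ : τ ∈ Set.Ici (-(n : ℝ))
    · rw [Set.indicator_of_mem hτ]
    · rw [Set.indicator_of_notMem hτ, h2]
      by_contra h0
      have h3 := hm (subset_tsupport g (Function.mem_support.2 (Ne.symm h0)))
      rw [mem_closedBall_zero_iff, Real.norm_eq_abs] at h3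
      have h4 : (N : ℝ) ≤ n := by exact_mod_cast hn
      exact hτ ((neg_le_neg (hN.trans h4)).trans (neg_le_of_abs_le h3))
  have h5 : truncFrom (-(n : ℝ)) f - f = truncFrom (-(n : ℝ)) (f - hg.toLp g) -
      (f - hg.toLp g) := by
    rw [map_sub, hgn]
    abel
  rw [dist_eq_norm, h5]
  have h6 := norm_sub_le (truncFrom (-(n : ℝ)) (f - hg.toLp g)) (f - hg.toLp g)
  have h7 := norm_truncFrom_le (-(n : ℝ)) (f - hg.toLp g)
  linarith

theorem evolLine_embedFrom (T : C0Semigroup E) (t : ℝ≥0) (a : ℝ) (g : LpHalf E p) :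
    evolLine p T t (embedFrom a g) = embedFrom a (evolHalf p T t g) := by
  change evolLine p T t (shift E p a (extendZero E p g)) =
    shift E p a (extendZero E p (evolHalf p T t g))
  rw [evolLine_shift, extendZero_evolHalf]

theorem truncFrom_evolLine (T : C0Semigroup E) (t : ℝ≥0) {a : ℝ} {f : LpLine E p}
    (hf : truncFrom a f = f) : truncFrom a (evolLine p T t f) = evolLine p T t f := by
  rw [← hf, truncFrom_apply a f, evolLine_embedFrom, truncFrom_embedFrom]

theorem embedFrom_mem_graph_iff (T : C0Semigroup E) (a : ℝ) (f g : LpHalf E p) :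
    (embedFrom a f, embedFrom a g) ∈ (genLine p T).graph ↔ (f, g) ∈ (genHalf p T).graph := by
  rw [mem_graph_genHalf_iff]
  refine ⟨fun h => ?_, fun h => shift_mem_graph_genLine h a⟩
  have := shift_mem_graph_genLine h (-a)
  change (shift E p (-a) (shift E p a (extendZero E p f)),
    shift E p (-a) (shift E p a (extendZero E p g))) ∈ _ at this
  simpa only [shift_shift, neg_add_cancel, shift_zero] using this

/-- On functions supported in `[a, ∞)` the operator `Γ_ℝ` has the lower bound of `Γ`. -/
theorem norm_le_of_truncFrom_eq {T : C0Semigroup E} (h : IsInvertible (genHalf p T)) {a : ℝ}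
    {u g : LpLine E p} (hug : (u, g) ∈ (genLine p T).graph) (hu : truncFrom a u = u)
    (hg : truncFrom a g = g) : ‖u‖ ≤ ‖inv (genHalf p T)‖ * ‖g‖ := by
  rw [← hu, ← hg, truncFrom_apply, truncFrom_apply, embedFrom_mem_graph_iff,
    mem_graph_iff_eq_inv h] at hug
  rw [← hu, ← hg, truncFrom_apply, truncFrom_apply, LinearIsometry.norm_map,
    LinearIsometry.norm_map, hug]
  exact ContinuousLinearMap.le_opNorm _ _

variable [CompleteSpace E]

/-- Functions supported in some `[a, ∞)` have preimages under `Γ_ℝ` by invertibility of `Γ`, with a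
bound independent of `a`; they are dense and `Γ_ℝ` is closed. -/
theorem exists_preimage_genLine (hp : p ≠ ∞) (T : C0Semigroup E)
    (h : IsInvertible (genHalf p T)) (g : LpLine E p) :
    ∃ u, (u, g) ∈ (genLine p T).graph ∧ ‖u‖ ≤ ‖inv (genHalf p T)‖ * ‖g‖ := by
  refine exists_preimage_of_dense (lineSemigroup hp T).isClosed_graph
    (K := {q | q ∈ (genLine p T).graph ∧ ∃ a : ℝ, truncFrom a q.1 = q.1 ∧ truncFrom a q.2 = q.2})
    (fun q hq => hq.1) ?_ ?_ ?_ g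
  · rintro q ⟨hq, a, ha1, ha2⟩ q' ⟨hq', b, hb1, hb2⟩
    refine ⟨Submodule.sub_mem _ hq hq', min a b, ?_, ?_⟩
    · rw [Prod.fst_sub, map_sub, truncFrom_of_le (min_le_left a b) ha1,
        truncFrom_of_le (min_le_right a b) hb1]
    · rw [Prod.snd_sub, map_sub, truncFrom_of_le (min_le_left a b) ha2,
        truncFrom_of_le (min_le_right a b) hb2]
  · rintro u g ⟨hug, a, hu, hg⟩
    exact norm_le_of_truncFrom_eq h hug hu hg
  · intro f
    refine mem_closure_of_tendsto (tendsto_truncFrom hp f) (Eventually.of_forall fun n => ?_)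
    refine ⟨embedFrom (-(n : ℝ)) (inv (genHalf p T) (partFrom (-(n : ℝ)) f)), ?_, -(n : ℝ),
      truncFrom_embedFrom _ _, truncFrom_truncFrom le_rfl f⟩
    rw [truncFrom_apply, embedFrom_mem_graph_iff]
    exact inv_mem_graph h _

/-- For `u` in the kernel of `Γ_ℝ` and `w = 1_[a,∞) u`, the function `v = ∫₀¹ E_ℝ^r w dr` is supported
in `[a, ∞)` and satisfies `Γ_ℝ v = E_ℝ^1 w - w`, which tends to `0` as `a → -∞`, while `v → u`. -/
theorem eq_zero_of_mem_graph_genLine (hp : p ≠ ∞) (T : C0Semigroup E)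
    (h : IsInvertible (genHalf p T)) {u : LpLine E p} (hu : (u, 0) ∈ (genLine p T).graph) :
    u = 0 := by
  set S := lineSemigroup hp T with hS
  have hSu : ∀ t : ℝ≥0, S.op t u = u := by
    intro t
    have := (S.mem_graph_iff_integral u 0).1 hu t
    simpa [sub_eq_zero] using this
  obtain ⟨M, hM0, hM⟩ := S.exists_bound 1
  have hw := tendsto_truncFrom hp u
  set w : ℕ → LpLine E p := fun n => truncFrom (-(n : ℝ)) u with hwdef
  have hg : Tendsto (fun n => S.op 1 (w n) - w n) atTop (𝓝 0) := by
    have := (((S.op 1).continuous.tendsto u).comp hw).sub hw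
    rwa [hSu, sub_self] at this
  set v : ℕ → LpLine E p := fun n => ∫ r in (0 : ℝ)..(1 : ℝ≥0), S.op r.toNNReal (w n) with hv
  have hvb : ∀ n, ‖v n‖ ≤ ‖inv (genHalf p T)‖ * ‖S.op 1 (w n) - w n‖ := by
    intro n
    have hwn : truncFrom (-(n : ℝ)) (w n) = w n := truncFrom_truncFrom le_rfl u
    have hE : ∀ t, truncFrom (-(n : ℝ)) (S.op t (w n)) = S.op t (w n) :=
      fun t => truncFrom_evolLine T t hwn
    refine norm_le_of_truncFrom_eq h (a := -(n : ℝ)) (S.integral_orbit_mem_graph 1 (w n)) ?_ ?_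
    · refine (ContinuousLinearMap.intervalIntegral_comp_comm (truncFrom (-(n : ℝ)))
        ((S.continuous_orbit (w n)).intervalIntegrable (μ := volume) 0 (1 : ℝ≥0))).symm.trans ?_
      exact intervalIntegral.integral_congr fun r _ => hE _
    · rw [map_sub, hE, hwn]
  have hvu : ∀ n, ‖u‖ ≤ ‖v n‖ + M * ‖w n - u‖ := by
    intro n
    have h1 : v n - u = ∫ r in (0 : ℝ)..(1 : ℝ≥0), S.op r.toNNReal (w n - u) := by
      simp only [map_sub]
      rw [intervalIntegral.integral_sub ((S.continuous_orbit _).intervalIntegrable _ _)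
        ((S.continuous_orbit _).intervalIntegrable _ _)]
      simp [hSu, hv]
    have h2 : ‖v n - u‖ ≤ M * ‖w n - u‖ * (1 : ℝ≥0) := by
      rw [h1]
      exact S.norm_integral_orbit_le 1 hM (w n - u)
    rw [NNReal.coe_one, mul_one] at h2
    have h3 := norm_sub_le (v n) (v n - u)
    rw [sub_sub_cancel] at h3
    linarith
  have hlim : Tendsto (fun n => ‖inv (genHalf p T)‖ * ‖S.op 1 (w n) - w n‖ + M * ‖w n - u‖)
      atTop (𝓝 0) := by
    have h1 := hg.norm.const_mul ‖inv (genHalf p T)‖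
    have h2 := (tendsto_iff_norm_sub_tendsto_zero.1 hw).const_mul M
    simpa using h1.add h2
  have := ge_of_tendsto' hlim fun n => (hvu n).trans (add_le_add_left (hvb n) _)
  exact norm_le_zero_iff.1 this

/-- Invertibility of `Γ` on the half-line implies invertibility of `Γ_ℝ` on the line. -/
theorem isInvertible_genLine_of_genHalf (hp : p ≠ ∞) (T : C0Semigroup E)
    (h : IsInvertible (genHalf p T)) : IsInvertible (genLine p T) := by
  obtain ⟨R, hR, -⟩ := exists_isResolventAt_zero (A := genLine p T)
    (norm_nonneg (inv (genHalf p T))) (fun u hu => eq_zero_of_mem_graph_genLine hp T h hu)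
    (exists_preimage_genLine hp T h)
  exact ⟨R, hR⟩

omit [CompleteSpace E] in
theorem inv_genLine_embedFrom {T : C0Semigroup E} (h : IsInvertible (genHalf p T))
    (h' : IsInvertible (genLine p T)) (a : ℝ) (g : LpHalf E p) :
    inv (genLine p T) (embedFrom a g) = embedFrom a (inv (genHalf p T) g) :=
  ((mem_graph_iff_eq_inv h').1 ((embedFrom_mem_graph_iff T a _ _).2 (inv_mem_graph h g))).symm

end Truncation

section HalfLine

variable {X U Y : Type*} [NormedAddCommGroup X] [NormedSpace ℂ X]
    [NormedAddCommGroup U] [NormedSpace ℂ U] [NormedAddCommGroup Y] [NormedSpace ℂ Y]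
    {p : ℝ≥0∞} [Fact (1 ≤ p)]

theorem mulLine_embedFrom (L : X →L[ℂ] Y) (a : ℝ) (g : LpHalf X p) :
    mulLine p L (embedFrom a g) = embedFrom a (mulHalf p L g) := by
  change mulLine p L (shift X p a (extendZero X p g)) = shift Y p a (extendZero Y p _)
  rw [mulLine_shift, mulLine_extendZero]

theorem sysLine_embedFrom {T : C0Semigroup X} (B : U →L[ℂ] X) (C : X →L[ℂ] Y)
    (h : IsInvertible (genHalf p T)) (h' : IsInvertible (genLine p T)) (a : ℝ) (g : LpHalf U p) :
    sysLine p T B C (embedFrom a g) = embedFrom a (sysHalf p T B C g) := by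
  simp only [sysLine, sysHalf, ContinuousLinearMap.comp_apply, mulLine_embedFrom,
    inv_genLine_embedFrom h h']

theorem norm_sysHalf_eq (hp : p ≠ ∞) {T : C0Semigroup X} (B : U →L[ℂ] X) (C : X →L[ℂ] Y)
    (h : IsInvertible (genHalf p T)) (h' : IsInvertible (genLine p T)) :
    ‖sysHalf p T B C‖ = ‖sysLine p T B C‖ := by
  refine le_antisymm ?_ ?_
  · refine ContinuousLinearMap.opNorm_le_bound _ (norm_nonneg _) fun g => ?_
    rw [← (embedFrom (E := Y) (p := p) 0).norm_map, ← sysLine_embedFrom B C h h']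
    refine (ContinuousLinearMap.le_opNorm _ _).trans_eq ?_
    rw [LinearIsometry.norm_map]
  · refine ContinuousLinearMap.opNorm_le_bound _ (norm_nonneg _) fun f => ?_
    have hlim := (((sysLine p T B C).continuous.tendsto f).comp (tendsto_truncFrom hp f)).norm
    refine le_of_tendsto' hlim fun n => ?_
    simp only [Function.comp]
    rw [truncFrom_apply, sysLine_embedFrom B C h h', LinearIsometry.norm_map]
    exact (ContinuousLinearMap.le_opNorm _ _).trans
      (mul_le_mul_of_nonneg_left (norm_partFrom_le _ f) (norm_nonneg _))

/-- For a function `w` vanishing on the negative half-line, the integral in the integrated form of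
`Γ_ℝ` over `[0, t]` with `t > τ` is a convolution over `[0, τ]`. -/
theorem integral_op_indicator (T : C0Semigroup X) (w : ℝ → X) {τ t : ℝ} (hτ : 0 ≤ τ)
    (hτt : τ ≤ t) :
    ∫ r in (0 : ℝ)..t, T.op r.toNNReal ((Set.Ici (0 : ℝ)).indicator w (τ - r)) =
      ∫ σ in (0 : ℝ)..τ, T.op (τ - σ).toNNReal (w σ) := by
  have h1 := intervalIntegral.integral_comp_sub_left (a := 0) (b := τ)
    (fun σ => T.op (τ - σ).toNNReal (w σ)) τ
  rw [sub_self, sub_zero] at h1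
  rw [← h1, intervalIntegral.integral_of_le hτ, intervalIntegral.integral_of_le (hτ.trans hτt)]
  rw [setIntegral_eq_of_subset_of_forall_sdiff_eq_zero measurableSet_Ioc
    (Set.Ioc_subset_Ioc_right hτt)]
  · refine setIntegral_congr_fun measurableSet_Ioc fun r hr => ?_
    have : τ - r ∈ Set.Ici (0 : ℝ) := sub_nonneg.2 hr.2
    simp only [Set.indicator_of_mem this, sub_sub_cancel]
  · intro r hr
    have : τ - r ∉ Set.Ici (0 : ℝ) := by
      intro h
      exact hr.2 ⟨hr.1.1, sub_nonneg.1 h⟩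
    rw [Set.indicator_of_notMem this, map_zero]

variable [CompleteSpace X]

/-- Variation of constants for `Γ v = w`. -/
theorem inv_genHalf_coeFn (hp : p ≠ ∞) (T : C0Semigroup X) (h : IsInvertible (genHalf p T))
    (w : LpHalf X p) (w' : ℝ → X) (hw' : w =ᵐ[halfVolume] w') :
    ∀ᵐ t ∂halfVolume,
      -inv (genHalf p T) w t = ∫ σ in (0 : ℝ)..t, T.op (t - σ).toNNReal (w' σ) := by
  have h1 := (mem_graph_genLine_iff hp T _ _).1
    ((mem_graph_genHalf_iff T _ _).1 (inv_mem_graph h w))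
  set v := inv (genHalf p T) w
  have h2 : ∀ᵐ τ : ℝ, ∀ n : ℕ, T.op n (extendZero X p v (τ - (n : ℝ≥0))) - extendZero X p v τ =
      ∫ r in (0 : ℝ)..(n : ℝ≥0), T.op r.toNNReal (extendZero X p w (τ - r)) :=
    ae_all_iff.2 fun n => h1 n
  have hv := extendZero_coeFn v
  have hvn : ∀ᵐ τ : ℝ, ∀ n : ℕ, extendZero X p v (τ - (n : ℝ≥0)) =
      (Set.Ici (0 : ℝ)).indicator v (τ - (n : ℝ≥0)) :=
    ae_all_iff.2 fun n => ae_comp_sub hv _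
  have hw := (extendZero_coeFn w).trans (indicator_ae_eq hw')
  refine (ae_restrict_iff' measurableSet_Ici).2 ?_
  filter_upwards [h2, hv, hvn] with τ h2 hv hvn hτ
  -- At a time `n > τ` the translated function `v (τ - n)` vanishes.
  obtain ⟨n, hn⟩ := exists_nat_gt τ
  have hτn : τ - ((n : ℝ≥0) : ℝ) ∉ Set.Ici (0 : ℝ) := by
    simp only [Set.mem_Ici, not_le, NNReal.coe_natCast, sub_neg]
    exact hn
  have h3 := h2 n
  rw [hvn, Set.indicator_of_notMem hτn, map_zero, zero_sub, hv, Set.indicator_of_mem hτ] at h3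
  rw [h3, ← integral_op_indicator T w' hτ (t := (n : ℝ≥0)) (by simpa using hn.le)]
  refine intervalIntegral.integral_congr_ae ?_
  have h4 : ∀ᵐ r : ℝ, extendZero X p w (τ - r) = (Set.Ici (0 : ℝ)).indicator w' (τ - r) :=
    (Measure.measurePreserving_sub_left volume τ).quasiMeasurePreserving.ae hw
  filter_upwards [h4] with r h4 _
  rw [h4]

/-- The operator `-𝓒 Γ⁻¹ 𝓑` is the input-output operator, by variation of constants. -/
theorem isInputOutputOperator_neg_sysHalf (hp : p ≠ ∞) (T : C0Semigroup X) (B : U →L[ℂ] X)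
    (C : X →L[ℂ] Y) (h : IsInvertible (genHalf p T)) :
    IsInputOutputOperator p T B C (-sysHalf p T B C) := by
  intro u
  have h1 := mulHalf_coeFn C (inv (genHalf p T) (mulHalf p B u))
  have h2 := inv_genHalf_coeFn hp T h _ _ (mulHalf_coeFn B u)
  filter_upwards [h1, h2, Lp.coeFn_neg (sysHalf p T B C u)] with t h1 h2 h3
  rw [← h2, map_neg, ← h1]
  exact h3

end HalfLine

/-! ### Hilbert spaces -/

section Hilbert

variable {X U Y : Type*} [NormedAddCommGroup X] [NormedSpace ℂ X]
    [NormedAddCommGroup U] [InnerProductSpace ℂ U] [CompleteSpace U]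
    [NormedAddCommGroup Y] [InnerProductSpace ℂ Y] [CompleteSpace Y]

/-- Plancherel's theorem for `τ ↦ ∫ v(s) e^{isτ} ds`. -/
theorem norm_expSchwartz_toLp_sq (v : 𝓢(ℝ, U)) :
    ‖(expSchwartz v).toLp 2 (volume : Measure ℝ)‖ ^ 2 = 2 * Real.pi * ∫ s, ‖v s‖ ^ 2 := by
  have h1 : ∫ τ, ‖expSchwartz v τ‖ ^ 2 =
      2 * Real.pi * ∫ s, ‖(FourierTransformInv.fourierInv v : 𝓢(ℝ, U)) s‖ ^ 2 := by
    have := Measure.integral_comp_mul_right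
      (fun s => ‖(FourierTransformInv.fourierInv v : 𝓢(ℝ, U)) s‖ ^ 2) (2 * Real.pi)⁻¹
    rw [inv_inv, abs_of_pos Real.two_pi_pos, smul_eq_mul] at this
    exact this
  have h2 := SchwartzMap.integral_norm_sq_fourier (FourierTransformInv.fourierInv v : 𝓢(ℝ, U))
  have h3 : (FourierTransform.fourier (FourierTransformInv.fourierInv v : 𝓢(ℝ, U)) : 𝓢(ℝ, U)) = v :=
    FourierTransform.fourier_fourierInv_eq v
  rw [h3] at h2
  rw [h2, ← h1, SchwartzMap.norm_toLp' (by norm_num) (by norm_num), ← Real.rpow_natCast,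
    ← Real.rpow_mul (by positivity)]
  norm_num

variable [CompleteSpace X] {p : ℝ≥0∞} [Fact (1 ≤ p)]

theorem norm_sysLine_le_iff (hp : p = 2) (T : C0Semigroup X) (B : U →L[ℂ] X) (C : X →L[ℂ] Y)
    (h : IsInvertible (genLine p T)) {c : ℝ} (hc : 0 ≤ c) :
    ‖sysLine p T B C‖ ≤ c ↔
      ∀ u : 𝓢(ℝ, U), ∫ s, ‖transfer T B C s (u s)‖ ^ 2 ≤ c ^ 2 * ∫ s, ‖u s‖ ^ 2 := by
  subst hp
  have hR := (hasTemperateGrowth_res (by norm_num) T h).2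
  have key : ∀ u : 𝓢(ℝ, U), ‖sysLine 2 T B C ((expSchwartz u).toLp 2 volume)‖ ≤
      c * ‖(expSchwartz u).toLp 2 (volume : Measure ℝ)‖ ↔
      ∫ s, ‖transfer T B C s (u s)‖ ^ 2 ≤ c ^ 2 * ∫ s, ‖u s‖ ^ 2 := by
    intro u
    rw [← pow_le_pow_iff_left₀ (norm_nonneg _) (by positivity) two_ne_zero, mul_pow,
      sysLine_expSchwartz (by norm_num) T B C h hR, norm_expSchwartz_toLp_sq,
      norm_expSchwartz_toLp_sq, transferSchwartz_coe, mul_left_comm,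
      mul_le_mul_iff_right₀ Real.two_pi_pos]
  constructor
  · intro hle u
    exact (key u).1 (ContinuousLinearMap.le_of_opNorm_le _ hle _)
  · intro hu
    refine ContinuousLinearMap.opNorm_le_bound _ hc fun f => ?_
    have hcl : IsClosed {f | ‖sysLine 2 T B C f‖ ≤ c * ‖f‖} :=
      isClosed_le (by fun_prop) (by fun_prop)
    exact (denseRange_expSchwartz_toLp (by norm_num)).induction_on f hcl fun u => (key u).2 (hu u)

omit [CompleteSpace U] [CompleteSpace Y] in
/-- A pointwise bound on a continuous symbol follows from the integrated bound by localization. -/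
theorem norm_le_of_forall_integral_le {W : ℝ → U →L[ℂ] Y} (hW : Continuous W) {c : ℝ} (hc : 0 ≤ c)
    (h : ∀ u : 𝓢(ℝ, U), ∫ s, ‖W s (u s)‖ ^ 2 ≤ c ^ 2 * ∫ s, ‖u s‖ ^ 2) (s₀ : ℝ) :
    ‖W s₀‖ ≤ c := by
  refine ContinuousLinearMap.opNorm_le_bound _ hc fun x => ?_
  by_contra! hlt
  have hWx : Continuous fun s => W s x := hW.clm_apply continuous_const
  set g : ℝ → ℝ := fun s => ‖W s x‖ ^ 2 - c ^ 2 * ‖x‖ ^ 2 with hg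
  have hgc : Continuous g := by fun_prop
  have hg0 : 0 < g s₀ := by
    have := pow_lt_pow_left₀ hlt (by positivity) two_ne_zero
    rw [mul_pow] at this
    exact sub_pos.2 this
  obtain ⟨δ, hδ, hball⟩ := Metric.mem_nhds_iff.1 ((hgc.tendsto s₀).eventually (lt_mem_nhds hg0))
  let φ : ContDiffBump s₀ := ⟨δ / 2, δ, by positivity, by linarith⟩
  have hφc : Continuous φ := φ.continuous
  have hsupp : HasCompactSupport fun s => φ s • x := φ.hasCompactSupport.smul_right
  let u : 𝓢(ℝ, U) := hsupp.toSchwartzMap (φ.contDiff.smul contDiff_const)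
  have hu : ∀ s, u s = φ s • x := fun s => rfl
  have h1 : ∀ s, ‖W s (u s)‖ ^ 2 = φ s ^ 2 * ‖W s x‖ ^ 2 := by
    intro s
    rw [hu, ContinuousLinearMap.map_smul_of_tower, norm_smul, mul_pow, Real.norm_eq_abs, sq_abs]
  have h2 : ∀ s, ‖u s‖ ^ 2 = φ s ^ 2 * ‖x‖ ^ 2 := by
    intro s
    rw [hu, norm_smul, mul_pow, Real.norm_eq_abs, sq_abs]
  have hsq : HasCompactSupport fun s => φ s ^ 2 := by
    simp only [pow_two]
    exact φ.hasCompactSupport.mul_right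
  have hi1 : Integrable fun s => φ s ^ 2 * ‖W s x‖ ^ 2 :=
    Continuous.integrable_of_hasCompactSupport (by fun_prop) hsq.mul_right
  have hi2 : Integrable fun s => c ^ 2 * (φ s ^ 2 * ‖x‖ ^ 2) :=
    (Continuous.integrable_of_hasCompactSupport (by fun_prop) hsq.mul_right).const_mul _
  have h3 := h u
  simp only [h1, h2] at h3
  rw [← integral_const_mul, ← sub_nonpos, ← integral_sub hi1 hi2] at h3
  refine h3.not_gt ?_
  have h4 : ∀ s, φ s ^ 2 * ‖W s x‖ ^ 2 - c ^ 2 * (φ s ^ 2 * ‖x‖ ^ 2) = φ s ^ 2 * g s := by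
    intro s
    rw [hg]
    ring
  simp only [h4]
  refine Continuous.integral_pos_of_hasCompactSupport_nonneg_nonzero (x := s₀) (by fun_prop)
    hsq.mul_right (fun s => ?_) ?_
  · by_cases hs : s ∈ Metric.ball s₀ δ
    · exact mul_nonneg (sq_nonneg _) (le_of_lt (hball hs))
    · have : φ s = 0 := φ.zero_of_le_dist (not_lt.1 hs)
      simp [this]
  · have : φ s₀ = 1 := φ.one_of_mem_closedBall (Metric.mem_closedBall_self (by positivity))
    simp [this, hg0.ne']

omit [CompleteSpace U] in
theorem integrable_norm_sq (v : 𝓢(ℝ, U)) : Integrable fun s => ‖v s‖ ^ 2 :=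
  (memLp_two_iff_integrable_sq_norm v.continuous.aestronglyMeasurable).1 (v.memLp 2 volume)

theorem enorm_sysLine_eq_iSup_transfer (hp : p = 2) (T : C0Semigroup X) (B : U →L[ℂ] X)
    (C : X →L[ℂ] Y) (h : IsInvertible (genLine p T)) :
    ‖sysLine p T B C‖ₑ = ⨆ s : ℝ, ‖transfer T B C s‖ₑ := by
  have hpt : p ≠ ∞ := by rw [hp]; norm_num
  have hR := (hasTemperateGrowth_res hpt T h).2
  have hRc : Continuous fun s : ℝ => res (generator T.op) (Complex.I * s) := hR.1.continuous
  have hW : Continuous (transfer T B C) :=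
    (continuous_const.clm_comp hRc).clm_comp continuous_const
  refine le_antisymm ?_ (iSup_le fun s => ?_)
  · set K := ⨆ s : ℝ, ‖transfer T B C s‖ₑ with hK
    by_cases hT : K = ∞
    · rw [hT]; exact le_top
    lift K to ℝ≥0 using hT with k
    have hk : ∀ s, ‖transfer T B C s‖ ≤ k := by
      intro s
      have h1 : ‖transfer T B C s‖ₑ ≤ k := by
        rw [hK]; exact le_iSup (fun s : ℝ => ‖transfer T B C s‖ₑ) s
      rw [enorm_eq_nnnorm] at h1
      exact_mod_cast h1
    have h2 : ‖sysLine p T B C‖₊ ≤ k := by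
      refine (norm_sysLine_le_iff hp T B C h k.2).2 fun u => ?_
      rw [← integral_const_mul]
      refine integral_mono (integrable_norm_sq (transferSchwartz T B C hR u))
        ((integrable_norm_sq u).const_mul _) fun s => ?_
      simp only
      rw [← mul_pow]
      exact pow_le_pow_left₀ (norm_nonneg _) ((transfer T B C s).le_of_opNorm_le (hk s) _) 2
    rw [enorm_eq_nnnorm]
    exact_mod_cast h2
  · have h1 := norm_le_of_forall_integral_le hW (norm_nonneg (sysLine p T B C))
      ((norm_sysLine_le_iff hp T B C h (norm_nonneg _)).1 le_rfl) s
    rw [enorm_eq_nnnorm, enorm_eq_nnnorm]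
    exact_mod_cast h1

end Hilbert

end EvolutionSemigroup

theorem theorem3p11 {X U Y : Type*}
    [NormedAddCommGroup X] [NormedSpace ℂ X] [CompleteSpace X]
    [NormedAddCommGroup U] [NormedSpace ℂ U] [CompleteSpace U]
    [NormedAddCommGroup Y] [NormedSpace ℂ Y] [CompleteSpace Y]
    (T : C0Semigroup X) (B : U →L[ℂ] X) (C : X →L[ℂ] Y)
    (p : ℝ≥0∞) [Fact (1 ≤ p)] (hp : p ≠ ∞) :
    (IsInvertible (genLine p T) →
      (∀ s : ℝ, InResolventSet (generator T.op) (Complex.I * s)) ∧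
      (∀ (u : 𝓢(ℝ, U)) (τ : ℝ),
        Integrable fun s : ℝ => Complex.exp (Complex.I * s * τ) • transfer T B C s (u s)) ∧
      ‖sysLine p T B C‖ₑ =
        ⨆ u : {u : 𝓢(ℝ, U) // u ≠ 0},
          eLpNorm (expIntegral fun s => transfer T B C s (u.1 s)) p volume /
            eLpNorm (expIntegral fun s => u.1 s) p volume) ∧
    (IsInvertible (genHalf p T) →
      IsInvertible (genLine p T) ∧
      ∃ L : LpHalf U p →L[ℂ] LpHalf Y p,
        IsInputOutputOperator p T B C L ∧
        L = -sysHalf p T B C ∧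
        ‖L‖ = ‖sysLine p T B C‖ ∧
        (IsHilbertNorm U → IsHilbertNorm Y → p = 2 →
          ‖L‖ₑ = ⨆ s : ℝ, ‖transfer T B C s‖ₑ)) := by
  refine ⟨fun h => ⟨fun s => ?_, fun u τ => ?_, enorm_sysLine_eq_iSup hp T B C h⟩, fun h => ?_⟩
  · obtain ⟨R, hR, -⟩ := exists_isResolventAt_imaginary hp T h s
    exact ⟨R, hR⟩
  · have hR := (hasTemperateGrowth_res hp T h).2
    exact integrable_exp_smul (transferSchwartz T B C hR u).integrable τ
  · have h' := isInvertible_genLine_of_genHalf hp T h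
    have hnorm : ‖-sysHalf p T B C‖ = ‖sysLine p T B C‖ := by
      rw [norm_neg, norm_sysHalf_eq hp B C h h']
    refine ⟨h', -sysHalf p T B C, isInputOutputOperator_neg_sysHalf hp T B C h, rfl, hnorm, ?_⟩
    rintro ⟨iU, rfl⟩ ⟨iY, rfl⟩ hp2
    rw [← enorm_sysLine_eq_iSup_transfer hp2 T B C h', enorm_eq_nnnorm, enorm_eq_nnnorm]
    exact ENNReal.coe_inj.2 (NNReal.eq hnorm)
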